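/- **Theorem 5.1 (Models with External Field).** Let $n\ge 1$ and $I=\{1,\dots,n\}$. For $N\ge n$ let $k(1,N),\dots,k(n,N)$ be non-negative integers with $\sum_j k(j,N)=N$ and $k(j,N)/N\to p_j>0$ for $1\le j\le n$. Write $\sigma\in\{+1,-1\}^N$ as $\sigma=\sigma_1\sigma_2\cdots\sigma_n$ with $\sigma_i\in\{+1,-1\}^{k(i,N)}$, and let $\overline\sigma_i$ be the sum of the entries of $\sigma_i$. Let $S$ be the set of all non-empty ordered sequences $s=\langle i_1,\dots,i_m\rangle$ of distinct elements of $I$; for such $s$ put $\sigma(s)=\sigma_{i_1}\sigma_{i_2}\cdots\sigma_{i_m}$. For $A\subseteq I$ let $S_A$ be the set of those $s\in S$ all of whose entries lie in $A$. For each $s\in S$ let $(\lambda_N^s)_{N\ge n}$ be probability measures on $\mathbb R$ which converge weakly to $\delta_0$ and satisfy the large deviation principle (LDP; speed $N$, upper bound for closed sets, lower bound for open sets) with a convex, lower semicontinuous rate function $\mathcal I_s:\mathbb R\to[0,\infty]$. On a probability space let, for each fixed $N\ge n$, the random variables $\xi(s,\sigma(s))$ (indexed by $s\in S$ and the possible values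 of $\sigma(s)$) be independent, $\xi(s,\sigma(s))$ having law $\lambda_N^s$; nothing is assumed about the joint law for different $N$. Let $$\mu_N(\omega)=\frac1{2^N}\sum_{\sigma\in\{+1,-1\}^N}\delta\Big\langle\big(\xi(s,\sigma(s),\omega)\big)_{s\in S},\big(\overline\sigma_i/N\big)_{1\le i\le n}\Big\rangle,$$ a probability measure on $\mathbb R^S\times\mathbb R^n$. Let $\mathcal I_0(y)=\frac{1+y}2\log(1+y)+\frac{1-y}2\log(1-y)$ for $|y|\le1$ (with $0\log 0=0$) and $\mathcal I_0(y)=\infty$ for $|y|>1$. Let $$D=\Big\{(x,y)\in\mathbb R^S\times\mathbb R^n:\ \forall A\subseteq I,\ \sum_{t\in S_A}\mathcal I_t(x_t)+\sum_{i\in A}p_i\,\mathcal I_0\Big(\frac{y_i}{p_i}\Big)\le\sum_{k\in A}p_k\log2\Big\},$$ and $\mathcal J(x,y)=\sum_{s\in S}\mathcal I_s(x_s)+\sum_{i\in I}p_i\,\mathcal I_0(y_i/p_i)$ if $(x,y)\in D$, $\mathcal J(x,y)=\infty$ otherwise. Then for almost every $\omega$: 1. $\mathcal J$ is lower semicontinuous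 and $(\mu_N(\omega))_{N\ge n}$ satisfies the weak LDP with rate function $\mathcal J$ (lower bound for all open sets, upper bound for all compact sets); 2. if, moreover, each of the sets $\{x:\mathcal I_s(x)\le\log 2\}$, $s\in S$, is bounded (in particular, if the rate functions $\mathcal I_s$ have compact level sets), then $(\mu_N(\omega))_{N\ge n}$ satisfies the full LDP with rate function $\mathcal J$ (upper bound for all closed sets), and the sets $\{\mathcal J\le c\}$, $c<\infty$, are compact. -/

import Mathlib

open Filter Topology MeasureTheory ProbabilityTheory
open scoped ENNReal NNReal

/-! ## Large deviation principles (speed `N`) -/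

section LargeDeviations

variable {X : Type*} [TopologicalSpace X] [MeasurableSpace X]

/-- Exponential decay rate `(1/N) log μ_N(B)` with `log 0 = -∞`. -/
noncomputable def logRate (μ : ℕ → Measure X) (B : Set X) (N : ℕ) : EReal :=
  ENNReal.log (μ N B) / (N : EReal)

/-- The full large deviation principle for the sequence `μ_N` with rate function `I`:
`I : X → [0,∞]` is lower semicontinuous, the upper bound holds for closed sets and the lower
bound for open sets. -/
structure SatisfiesLDP (μ : ℕ → Measure X) (I : X → ℝ≥0∞) : Prop where
  lsc : LowerSemicontinuous I
  upper : ∀ F : Set X, IsClosed F →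
    limsup (logRate μ F) atTop ≤ -(⨅ x ∈ F, ((I x : ℝ≥0∞) : EReal))
  lower : ∀ G : Set X, IsOpen G →
    -(⨅ x ∈ G, ((I x : ℝ≥0∞) : EReal)) ≤ liminf (logRate μ G) atTop

/-- The weak large deviation principle: as the full one, but with the upper bound for compact
sets only. -/
structure SatisfiesWeakLDP (μ : ℕ → Measure X) (I : X → ℝ≥0∞) : Prop where
  lsc : LowerSemicontinuous I
  upper : ∀ F : Set X, IsCompact F →
    limsup (logRate μ F) atTop ≤ -(⨅ x ∈ F, ((I x : ℝ≥0∞) : EReal))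
  lower : ∀ G : Set X, IsOpen G →
    -(⨅ x ∈ G, ((I x : ℝ≥0∞) : EReal)) ≤ liminf (logRate μ G) atTop

end LargeDeviations

/-! ## Spin configurations -/

/-- The set `S` of non-empty ordered sequences `⟨i_1, …, i_m⟩` of distinct elements of an index
set with `n` elements (`s.1 + 1` is the length of `s`, necessarily between `1` and `n`). -/
abbrev OrdSeq (n : ℕ) : Type := Σ m : Fin n, (Fin ((m : ℕ) + 1) ↪ Fin n)

/-- A configuration in `{+1,-1}^{k_1} × ⋯ × {+1,-1}^{k_n}`. -/
abbrev Config {n : ℕ} (k : Fin n → ℕ) : Type := (i : Fin n) → Fin (k i) → ℤˣ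

/-- The values which `σ(s) = σ_{i_1} σ_{i_2} ⋯ σ_{i_m}` can take, for `s = ⟨i_1, …, i_m⟩`. -/
abbrev SubConfig {n : ℕ} (k : Fin n → ℕ) (s : OrdSeq n) : Type :=
  (j : Fin ((s.1 : ℕ) + 1)) → Fin (k (s.2 j)) → ℤˣ

/-- `σ(s)`. -/
def subConfig {n : ℕ} {k : Fin n → ℕ} (σ : Config k) (s : OrdSeq n) : SubConfig k s :=
  fun j => σ (s.2 j)

/-- The sum of the spins of a block. -/
def blockSum {m : ℕ} (τ : Fin m → ℤˣ) : ℝ := ∑ j, ((τ j : ℤ) : ℝ)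

/-- The empirical measure
`2^{-N} ∑_σ δ_{((ξ(s,σ(s)))_s, (σ̄_i / N)_i)}` on `ℝ^S × ℝ^n`. -/
noncomputable def empiricalMeasure {n : ℕ} (N : ℕ) (k : Fin n → ℕ)
    (ξ : (s : OrdSeq n) → SubConfig k s → ℝ) : Measure ((OrdSeq n → ℝ) × (Fin n → ℝ)) :=
  ((2 : ℝ≥0∞) ^ N)⁻¹ • ∑ σ : Config k,
    Measure.dirac ((fun s => ξ s (subConfig σ s)), (fun i => blockSum (σ i) / (N : ℝ)))

/-! ## The rate function -/

/-- The Cramér rate function of fair coin tossing with values `±1`. The expression for `|y| ≤ 1`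
is non-negative, and it is `log 2` at `y = ±1` by the convention `0 log 0 = 0`. -/
noncomputable def coinRate (y : ℝ) : ℝ≥0∞ :=
  if |y| ≤ 1 then
    ENNReal.ofReal ((1 + y) / 2 * Real.log (1 + y) + (1 - y) / 2 * Real.log (1 - y))
  else ⊤

/-- The partial sum `∑_{t ∈ S_A} I_t(x_t) + ∑_{i ∈ A} p_i I_0(y_i / p_i)`, where `S_A` is the set
of the sequences with all entries in `A`. -/
noncomputable def partialRate {n : ℕ} (I : OrdSeq n → ℝ → ℝ≥0∞) (p : Fin n → ℝ)
    (A : Finset (Fin n)) (z : (OrdSeq n → ℝ) × (Fin n → ℝ)) : ℝ≥0∞ :=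
  (∑ t : OrdSeq n with (∀ j, t.2 j ∈ A), I t (z.1 t)) +
    ∑ i ∈ A, ENNReal.ofReal (p i) * coinRate (z.2 i / p i)

/-- The set on which the rate function of the model is finite. -/
def rateSupport {n : ℕ} (I : OrdSeq n → ℝ → ℝ≥0∞) (p : Fin n → ℝ) :
    Set ((OrdSeq n → ℝ) × (Fin n → ℝ)) :=
  {z | ∀ A : Finset (Fin n),
    partialRate I p A z ≤ ENNReal.ofReal (∑ i ∈ A, p i * Real.log 2)}

open Classical in
/-- The rate function `J` of the model. -/
noncomputable def modelRate {n : ℕ} (I : OrdSeq n → ℝ → ℝ≥0∞) (p : Fin n → ℝ)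
    (z : (OrdSeq n → ℝ) × (Fin n → ℝ)) : ℝ≥0∞ :=
  if z ∈ rateSupport I p then
    (∑ s : OrdSeq n, I s (z.1 s)) +
      ∑ i : Fin n, ENNReal.ofReal (p i) * coinRate (z.2 i / p i)
  else ⊤

/-! The empirical measure of a box is 2^{-N} times the number of configurations whose energies and
magnetisations fall into it. For A ⊆ I, the expected number of restrictions to A that meet the
constraints indexed by A is at most 2^{k(A)} `boxProb` A, where k(A) is the sum of k(i,N) over A and
`boxProb` is a product of one-dimensional probabilities. By the assumed LDPs and Cramér's theorem
for coin tossing, in a small box around z this is about exp(N(∑_{i∈A} p_i log 2 - `partialRate` A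
z)). Thus D is the set where none of these quantities has a negative exponential rate.

Upper bound. If some A violates its inequality at z, the union bound over restrictions to A and
Borel–Cantelli show that a small box around z is eventually empty, which gives rate ∞
(`ae_eventually_forall_notMem_energyEvent`). Otherwise Markov's inequality for the full count gives
the rate `partialRate` univ z (`ae_decaysAtLeast_empiricalMeasure_box`).

Lower bound. Two configurations share exactly the variables ξ(s, ·) for which s has all its entries
in the set B of blocks where they agree. Hence their covariance vanishes for empty B, and the
variance of the count is at most the squared mean times the sum over non-empty B of 1/(2^{k(B)}
`boxProb` B). If all these denominators grow exponentially, Chebyshev's inequality and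
Borel–Cantelli keep the count above half its mean (`measure_energyCount_lt_le`). Points of D satisfy
only weak inequalities, so z is replaced by θz with θ < 1. Weak convergence to δ_0 forces I_s(0) =
0, and convexity then makes `partialRate` shrink at least by the factor θ, leaving a strict margin
for every non-empty B; it also yields |y_i| < p_i, where exponential tilting is available.

Boxes and rates are taken rational, so one null set serves all of them. Borel–Cantelli uses only
summability, so the joint law over different N is irrelevant. For the full LDP, convexity and
boundedness of {I_s ≤ log 2} give tails of rate greater than log 2, which beats the at most 2^N
values of σ(s): eventually all atoms lie in a fixed compact set. -/

/-! ## Exponential rates of decay -/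

/-- `u N ≤ exp (-c N)` for all large `N`. -/
def DecaysAtLeast (u : ℕ → ℝ≥0∞) (c : ℝ) : Prop :=
  ∀ᶠ N : ℕ in atTop, u N ≤ ENNReal.ofReal (Real.exp (-(c * N)))

/-- `exp (-c N) ≤ u N` for all large `N`. -/
def DecaysAtMost (u : ℕ → ℝ≥0∞) (c : ℝ) : Prop :=
  ∀ᶠ N : ℕ in atTop, ENNReal.ofReal (Real.exp (-(c * N))) ≤ u N

lemma log_div_natCast_le_iff {x : ℝ≥0∞} {N : ℕ} (hN : 0 < N) (c : ℝ) :
    ENNReal.log x / (N : EReal) ≤ ((-c : ℝ) : EReal) ↔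
      x ≤ ENNReal.ofReal (Real.exp (-(c * N))) := by
  have h0 : (0 : EReal) < (N : EReal) := by exact_mod_cast hN
  rw [EReal.div_le_iff_le_mul h0 (EReal.natCast_ne_top N), ← EReal.exp_le_exp_iff,
    ENNReal.exp_log]
  have : (N : EReal) * ((-c : ℝ) : EReal) = ((-(c * N) : ℝ) : EReal) := by
    rw [← EReal.coe_coe_eq_natCast, ← EReal.coe_mul]; congr 1; ring
  rw [this, EReal.exp_coe]

lemma le_log_div_natCast_iff {x : ℝ≥0∞} {N : ℕ} (hN : 0 < N) (c : ℝ) :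
    ((-c : ℝ) : EReal) ≤ ENNReal.log x / (N : EReal) ↔
      ENNReal.ofReal (Real.exp (-(c * N))) ≤ x := by
  have h0 : (0 : EReal) < (N : EReal) := by exact_mod_cast hN
  rw [EReal.le_div_iff_mul_le h0 (EReal.natCast_ne_top N), ← EReal.exp_le_exp_iff,
    ENNReal.exp_log]
  have : ((-c : ℝ) : EReal) * (N : EReal) = ((-(c * N) : ℝ) : EReal) := by
    rw [← EReal.coe_coe_eq_natCast, ← EReal.coe_mul]; congr 1; ring
  rw [this, EReal.exp_coe]

/-- Testing against every real rate below `a` turns limits in `EReal` into eventual inequalities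
between exponentials, and covers `a = ⊤` without a separate case. -/
lemma limsup_log_div_le {u : ℕ → ℝ≥0∞} {a : EReal}
    (h : ∀ c : ℝ, (c : EReal) < a → DecaysAtLeast u c) :
    limsup (fun N : ℕ => ENNReal.log (u N) / (N : EReal)) atTop ≤ -a := by
  refine EReal.le_of_forall_lt_iff_le.1 fun x hx => ?_
  have hc : ((-x : ℝ) : EReal) < a := by
    rw [EReal.coe_neg]; exact EReal.neg_lt_comm.1 hx
  refine limsup_le_of_le (by isBoundedDefault) ?_
  filter_upwards [h _ hc, eventually_gt_atTop 0] with N hN h0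
  simpa using (log_div_natCast_le_iff h0 (-x)).2 hN

lemma DecaysAtLeast.of_limsup {u : ℕ → ℝ≥0∞} {a : EReal}
    (h : limsup (fun N : ℕ => ENNReal.log (u N) / (N : EReal)) atTop ≤ -a) {c : ℝ}
    (hc : (c : EReal) < a) : DecaysAtLeast u c := by
  have : limsup (fun N : ℕ => ENNReal.log (u N) / (N : EReal)) atTop < ((-c : ℝ) : EReal) :=
    h.trans_lt (by rw [EReal.coe_neg]; exact EReal.neg_lt_neg_iff.2 hc)
  filter_upwards [eventually_lt_of_limsup_lt this, eventually_gt_atTop 0] with N hN h0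
  exact (log_div_natCast_le_iff h0 c).1 hN.le

lemma le_liminf_log_div {u : ℕ → ℝ≥0∞} {a : EReal}
    (h : ∀ c : ℝ, a < (c : EReal) → DecaysAtMost u c) :
    -a ≤ liminf (fun N : ℕ => ENNReal.log (u N) / (N : EReal)) atTop := by
  refine EReal.ge_of_forall_gt_iff_ge.1 fun x hx => ?_
  have hc : a < ((-x : ℝ) : EReal) := by
    rw [EReal.coe_neg]; exact EReal.lt_neg_comm.1 hx
  refine le_liminf_of_le (by isBoundedDefault) ?_
  filter_upwards [h _ hc, eventually_gt_atTop 0] with N hN h0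
  simpa using (le_log_div_natCast_iff h0 (-x)).2 hN

lemma DecaysAtMost.of_liminf {u : ℕ → ℝ≥0∞} {a : EReal}
    (h : -a ≤ liminf (fun N : ℕ => ENNReal.log (u N) / (N : EReal)) atTop) {c : ℝ}
    (hc : a < (c : EReal)) : DecaysAtMost u c := by
  have : ((-c : ℝ) : EReal) < liminf (fun N : ℕ => ENNReal.log (u N) / (N : EReal)) atTop :=
    lt_of_lt_of_le (by rw [EReal.coe_neg]; exact EReal.neg_lt_neg_iff.2 hc) h
  filter_upwards [eventually_lt_of_lt_liminf this, eventually_gt_atTop 0] with N hN h0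
  exact (le_log_div_natCast_iff h0 c).1 hN.le

lemma ofReal_exp_mul_ofReal_exp (x y : ℝ) :
    ENNReal.ofReal (Real.exp x) * ENNReal.ofReal (Real.exp y) =
      ENNReal.ofReal (Real.exp (x + y)) := by
  rw [← ENNReal.ofReal_mul (Real.exp_pos _).le, Real.exp_add]

lemma DecaysAtLeast.mono {u v : ℕ → ℝ≥0∞} {c d : ℝ} (h : DecaysAtLeast u c)
    (huv : ∀ N, v N ≤ u N) (hcd : d ≤ c) : DecaysAtLeast v d := by
  filter_upwards [h] with N hN
  refine (huv N).trans (hN.trans ?_)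
  gcongr

lemma DecaysAtMost.mono {u v : ℕ → ℝ≥0∞} {c d : ℝ} (h : DecaysAtMost u c)
    (huv : ∀ N, u N ≤ v N) (hcd : c ≤ d) : DecaysAtMost v d := by
  filter_upwards [h] with N hN
  refine le_trans ?_ (hN.trans (huv N))
  gcongr

lemma DecaysAtLeast.mul {u v : ℕ → ℝ≥0∞} {c d : ℝ} (hu : DecaysAtLeast u c)
    (hv : DecaysAtLeast v d) : DecaysAtLeast (fun N => u N * v N) (c + d) := by
  filter_upwards [hu, hv] with N h1 h2
  refine (mul_le_mul' h1 h2).trans_eq ?_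
  rw [ofReal_exp_mul_ofReal_exp]; congr 2; ring

lemma DecaysAtMost.mul {u v : ℕ → ℝ≥0∞} {c d : ℝ} (hu : DecaysAtMost u c)
    (hv : DecaysAtMost v d) : DecaysAtMost (fun N => u N * v N) (c + d) := by
  filter_upwards [hu, hv] with N h1 h2
  refine le_trans (le_of_eq ?_) (mul_le_mul' h1 h2)
  rw [ofReal_exp_mul_ofReal_exp]; congr 2; ring

lemma DecaysAtLeast.prod {ι : Type*} {s : Finset ι} {u : ι → ℕ → ℝ≥0∞} {c : ι → ℝ}
    (h : ∀ i ∈ s, DecaysAtLeast (u i) (c i)) :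
    DecaysAtLeast (fun N => ∏ i ∈ s, u i N) (∑ i ∈ s, c i) := by
  classical
  induction s using Finset.induction_on with
  | empty => exact Eventually.of_forall fun N => by simp
  | insert a s ha ih =>
    simp only [Finset.prod_insert ha, Finset.sum_insert ha]
    exact (h a (by simp)).mul (ih fun i hi => h i (by simp [hi]))

lemma DecaysAtMost.prod {ι : Type*} {s : Finset ι} {u : ι → ℕ → ℝ≥0∞} {c : ι → ℝ}
    (h : ∀ i ∈ s, DecaysAtMost (u i) (c i)) :
    DecaysAtMost (fun N => ∏ i ∈ s, u i N) (∑ i ∈ s, c i) := by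
  classical
  induction s using Finset.induction_on with
  | empty => exact Eventually.of_forall fun N => by simp
  | insert a s ha ih =>
    simp only [Finset.prod_insert ha, Finset.sum_insert ha]
    exact (h a (by simp)).mul (ih fun i hi => h i (by simp [hi]))

lemma eventually_two_mul_exp_le {c d : ℝ} (hcd : c < d) :
    ∀ᶠ N : ℕ in atTop, 2 * ENNReal.ofReal (Real.exp (-(d * N))) ≤
      ENNReal.ofReal (Real.exp (-(c * N))) := by
  have h1 : Tendsto (fun N : ℕ => (d - c) * (N : ℝ)) atTop atTop :=
    tendsto_natCast_atTop_atTop.const_mul_atTop (sub_pos.2 hcd)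
  filter_upwards [h1.eventually_ge_atTop (Real.log 2)] with N hN
  rw [← ENNReal.ofReal_ofNat 2, ← Real.exp_log (zero_lt_two), ofReal_exp_mul_ofReal_exp]
  gcongr
  linarith

/-- The factor 2 is absorbed by an arbitrarily small loss of rate, hence the strict inequality `c <
d`. -/
lemma DecaysAtLeast.add {u v : ℕ → ℝ≥0∞} {c d : ℝ} (hcd : c < d) (hu : DecaysAtLeast u d)
    (hv : DecaysAtLeast v d) : DecaysAtLeast (fun N => u N + v N) c := by
  filter_upwards [hu, hv, eventually_two_mul_exp_le hcd] with N h1 h2 h3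
  refine (add_le_add h1 h2).trans ?_
  rwa [← two_mul]

lemma DecaysAtMost.half {u : ℕ → ℝ≥0∞} {c d : ℝ} (hcd : c < d) (hu : DecaysAtMost u c) :
    DecaysAtMost (fun N => u N / 2) d := by
  filter_upwards [hu, eventually_two_mul_exp_le hcd] with N h1 h3
  rw [ENNReal.le_div_iff_mul_le (by simp) (by simp), mul_comm]
  exact h3.trans h1

/-- A local exponential bound on a compact set is a global one. -/
lemma IsCompact.decaysAtLeast {X : Type*} [TopologicalSpace X] [MeasurableSpace X]
    {μ : ℕ → Measure X} {K : Set X} (hK : IsCompact K) {c : ℝ}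
    (h : ∀ x ∈ K, ∃ t ∈ 𝓝 x, ∃ d, c < d ∧ DecaysAtLeast (fun N => μ N t) d) :
    DecaysAtLeast (fun N => μ N K) c := by
  -- A rate strictly above `c` is carried through the compactness induction, so that each union has
  -- room for its loss.
  suffices H : ∃ d, c < d ∧ DecaysAtLeast (fun N => μ N K) d by
    obtain ⟨d, hd, H⟩ := H
    exact H.mono (fun _ => le_rfl) hd.le
  refine hK.induction_on (p := fun t => ∃ d, c < d ∧ DecaysAtLeast (fun N => μ N t) d)
    ⟨c + 1, by linarith, Eventually.of_forall fun N => by simp⟩ ?_ ?_ ?_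
  · rintro s t hst ⟨d, hd, H⟩
    exact ⟨d, hd, H.mono (fun N => measure_mono hst) le_rfl⟩
  · rintro s t ⟨d, hd, H⟩ ⟨e, he, H'⟩
    obtain ⟨f, hf1, hf2⟩ := exists_between (lt_min hd he)
    refine ⟨f, hf1, (DecaysAtLeast.add hf2 (H.mono (fun _ => le_rfl) (min_le_left _ _))
      (H'.mono (fun _ => le_rfl) (min_le_right _ _))).mono (fun N => measure_union_le _ _) le_rfl⟩
  · intro x hx
    obtain ⟨t, ht, H⟩ := h x hx
    exact ⟨t, mem_nhdsWithin_of_mem_nhds ht, H⟩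

/-! ## Splitting strict inequalities between sums -/

lemma neg_one_lt_coe_ennreal (b : ℝ≥0∞) : ((-1 : ℝ) : EReal) < b :=
  lt_of_lt_of_le (EReal.coe_lt_coe_iff.2 (neg_one_lt_zero)) (EReal.coe_ennreal_nonneg b)

lemma exists_real_lt_add {a b : ℝ≥0∞} {c : ℝ} (h : (c : EReal) < ((a + b : ℝ≥0∞) : EReal)) :
    ∃ x y : ℝ, (x : EReal) < a ∧ (y : EReal) < b ∧ c < x + y := by
  induction a with
  | top =>
    -- An infinite summand supplies any real bound; -1 lies strictly below every value in [0,∞].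
    exact ⟨c + 2, -1, by simpa using EReal.coe_lt_top (c + 2), neg_one_lt_coe_ennreal b,
      by linarith⟩
  | coe a =>
    induction b with
    | top =>
      exact ⟨-1, c + 2, neg_one_lt_coe_ennreal _, by simpa using EReal.coe_lt_top (c + 2),
        by linarith⟩
    | coe b =>
      have h' : c < (a : ℝ) + b := by
        rw [← ENNReal.coe_add, EReal.coe_nnreal_eq_coe_real, EReal.coe_lt_coe_iff] at h
        simpa using h
      refine ⟨a - (a + b - c) / 3, b - (a + b - c) / 3, ?_, ?_, by linarith⟩
      · rw [EReal.coe_nnreal_eq_coe_real, EReal.coe_lt_coe_iff]; linarith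
      · rw [EReal.coe_nnreal_eq_coe_real, EReal.coe_lt_coe_iff]; linarith

lemma exists_real_lt_sum {ι : Type*} (s : Finset ι) (a : ι → ℝ≥0∞) {c : ℝ}
    (h : (c : EReal) < ((∑ i ∈ s, a i : ℝ≥0∞) : EReal)) :
    ∃ b : ι → ℝ, (∀ i, (b i : EReal) < a i) ∧ c < ∑ i ∈ s, b i := by
  classical
  induction s using Finset.induction_on generalizing c with
  | empty =>
    refine ⟨fun _ => -1, fun i => neg_one_lt_coe_ennreal _, ?_⟩
    simpa using h
  | insert j s hj ih =>
    rw [Finset.sum_insert hj] at h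
    obtain ⟨x, y, hx, hy, hxy⟩ := exists_real_lt_add h
    obtain ⟨b, hb, hb'⟩ := ih hy
    refine ⟨Function.update b j x, fun i => ?_, ?_⟩
    · by_cases hi : i = j
      · subst hi; simpa using hx
      · simpa [hi] using hb i
    · rw [Finset.sum_insert hj, Function.update_self]
      have : ∑ i ∈ s, Function.update b j x i = ∑ i ∈ s, b i :=
        Finset.sum_congr rfl fun i hi => Function.update_of_ne (by grind) _ _
      linarith

lemma exists_real_add_lt {a b : ℝ≥0∞} {c : ℝ} (h : ((a + b : ℝ≥0∞) : EReal) < c) :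
    ∃ x y : ℝ, (a : EReal) < x ∧ (b : EReal) < y ∧ x + y < c := by
  have hab : a + b ≠ ⊤ := by
    rintro hab
    simp [hab] at h
  lift a to ℝ≥0 using by rintro rfl; simp at hab
  lift b to ℝ≥0 using by rintro rfl; simp at hab
  have h' : (a : ℝ) + b < c := by
    rw [← ENNReal.coe_add, EReal.coe_nnreal_eq_coe_real, EReal.coe_lt_coe_iff] at h
    simpa using h
  refine ⟨a + (c - (a + b)) / 3, b + (c - (a + b)) / 3, ?_, ?_, by linarith⟩
  · rw [EReal.coe_nnreal_eq_coe_real, EReal.coe_lt_coe_iff]; linarith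
  · rw [EReal.coe_nnreal_eq_coe_real, EReal.coe_lt_coe_iff]; linarith

lemma exists_real_sum_lt {ι : Type*} (s : Finset ι) (a : ι → ℝ≥0∞) {c : ℝ}
    (h : ((∑ i ∈ s, a i : ℝ≥0∞) : EReal) < c) :
    ∃ b : ι → ℝ, (∀ i ∈ s, (a i : EReal) < b i) ∧ ∑ i ∈ s, b i < c := by
  classical
  induction s using Finset.induction_on generalizing c with
  | empty => exact ⟨fun _ => 0, by simp, by simpa using h⟩
  | insert j s hj ih =>
    rw [Finset.sum_insert hj] at h
    obtain ⟨x, y, hx, hy, hxy⟩ := exists_real_add_lt h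
    obtain ⟨b, hb, hb'⟩ := ih hy
    refine ⟨Function.update b j x, fun i hi => ?_, ?_⟩
    · by_cases hij : i = j
      · subst hij; simpa using hx
      · simpa [hij] using hb i (by grind)
    · rw [Finset.sum_insert hj, Function.update_self]
      have : ∑ i ∈ s, Function.update b j x i = ∑ i ∈ s, b i :=
        Finset.sum_congr rfl fun i hi => Function.update_of_ne (by grind) _ _
      linarith

/-! ## The rate function of fair coin tossing -/

/-- The finite branch of `coinRate`. -/
noncomputable def coinFun (u : ℝ) : ℝ :=
  (1 + u) / 2 * Real.log (1 + u) + (1 - u) / 2 * Real.log (1 - u)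

lemma coinRate_of_abs_le {u : ℝ} (hu : |u| ≤ 1) : coinRate u = ENNReal.ofReal (coinFun u) :=
  if_pos hu

lemma coinRate_of_lt_abs {u : ℝ} (hu : 1 < |u|) : coinRate u = ⊤ := if_neg (not_le.2 hu)

lemma coinFun_neg (u : ℝ) : coinFun (-u) = coinFun u := by
  simp only [coinFun, sub_neg_eq_add, ← sub_eq_add_neg]; ring

lemma coinRate_neg (u : ℝ) : coinRate (-u) = coinRate u := by
  rcases le_or_gt |u| 1 with h | h
  · rw [coinRate_of_abs_le h, coinRate_of_abs_le (by rwa [abs_neg]), coinFun_neg]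
  · rw [coinRate_of_lt_abs h, coinRate_of_lt_abs (by rwa [abs_neg])]

lemma continuous_coinFun : Continuous coinFun := by
  have h1 : Continuous fun u : ℝ => (1 + u) * Real.log (1 + u) :=
    Real.continuous_mul_log.comp (continuous_const.add continuous_id)
  have h2 : Continuous fun u : ℝ => (1 - u) * Real.log (1 - u) :=
    Real.continuous_mul_log.comp (continuous_const.sub continuous_id)
  have : coinFun = fun u => ((1 + u) * Real.log (1 + u)) / 2 + ((1 - u) * Real.log (1 - u)) / 2 := by
    funext u; simp only [coinFun]; ring
  rw [this]
  fun_prop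

/-- Convexity of x log x on the segment from 1 + v to 1, where the function vanishes, applied to v =
u and v = -u. -/
lemma coinFun_mul_le {u θ : ℝ} (hu : |u| ≤ 1) (h0 : 0 ≤ θ) (h1 : θ ≤ 1) :
    coinFun (θ * u) ≤ θ * coinFun u := by
  obtain ⟨hu1, hu2⟩ := abs_le.1 hu
  have key : ∀ v : ℝ, -1 ≤ v → (1 + θ * v) * Real.log (1 + θ * v) ≤
      θ * ((1 + v) * Real.log (1 + v)) := by
    intro v hv
    have := Real.convexOn_mul_log.2 (Set.mem_Ici.2 (by linarith : 0 ≤ 1 + v))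
      (Set.mem_Ici.2 (zero_le_one' ℝ)) h0 (by linarith : 0 ≤ 1 - θ) (by ring)
    simp only [smul_eq_mul, mul_one, Real.log_one, mul_zero, add_zero] at this
    have e : θ * (1 + v) + (1 - θ) = 1 + θ * v := by ring
    rwa [e] at this
  have k1 := key u hu1
  have k2 := key (-u) (by linarith)
  simp only [mul_neg, ← sub_eq_add_neg] at k2
  simp only [coinFun]
  linarith

lemma coinRate_mul_le {u θ : ℝ} (h0 : 0 < θ) (h1 : θ ≤ 1) :
    coinRate (θ * u) ≤ ENNReal.ofReal θ * coinRate u := by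
  rcases le_or_gt |u| 1 with h | h
  · have h' : |θ * u| ≤ 1 := by
      rw [abs_mul, abs_of_pos h0]; exact mul_le_one₀ h1 (abs_nonneg _) h
    rw [coinRate_of_abs_le h, coinRate_of_abs_le h', ← ENNReal.ofReal_mul h0.le]
    exact ENNReal.ofReal_le_ofReal (coinFun_mul_le h h0.le h1)
  · rw [coinRate_of_lt_abs h, ENNReal.mul_top (by simpa using h0)]
    exact le_top

lemma lowerSemicontinuous_coinRate : LowerSemicontinuous coinRate := by
  intro u c hc
  rcases le_or_gt |u| 1 with h | h
  · rw [coinRate_of_abs_le h] at hc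
    have : ContinuousAt (fun v => ENNReal.ofReal (coinFun v)) u :=
      (ENNReal.continuous_ofReal.comp continuous_coinFun).continuousAt
    filter_upwards [this.eventually_const_lt hc] with v hv
    rcases le_or_gt |v| 1 with h' | h'
    · rwa [coinRate_of_abs_le h']
    · rw [coinRate_of_lt_abs h']; exact hv.trans_le le_top
  · filter_upwards [continuous_abs.continuousAt.eventually_const_lt h] with v hv
    rw [coinRate_of_lt_abs h] at hc
    rwa [coinRate_of_lt_abs hv]

/-- The Legendre transform of log cosh is attained at t = artanh u, the tilt under which a spin has
mean u. With t = a - b, e^{2a} = 1 + u and e^{2b} = 1 - u, one has cosh t = e^{-(a+b)}. -/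
lemma exists_tilt {u : ℝ} (hu : |u| < 1) :
    ∃ t : ℝ, Real.sinh t = u * Real.cosh t ∧ t * u - Real.log (Real.cosh t) = coinFun u := by
  obtain ⟨hu1, hu2⟩ := abs_lt.1 hu
  obtain ⟨a, ha⟩ : ∃ a, a = Real.log (1 + u) / 2 := ⟨_, rfl⟩
  obtain ⟨b, hb⟩ : ∃ b, b = Real.log (1 - u) / 2 := ⟨_, rfl⟩
  have hA : Real.exp a * Real.exp a = 1 + u := by
    rw [← Real.exp_add, ha, add_halves, Real.exp_log (by linarith)]
  have hB : Real.exp b * Real.exp b = 1 - u := by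
    rw [← Real.exp_add, hb, add_halves, Real.exp_log (by linarith)]
  have pa := Real.exp_pos a
  have pb := Real.exp_pos b
  have hc : Real.cosh (a - b) = Real.exp (-(a + b)) := by
    rw [Real.cosh_eq, neg_sub, Real.exp_sub, Real.exp_sub, Real.exp_neg, Real.exp_add]
    field_simp
    nlinarith
  have hs : Real.sinh (a - b) = u * Real.exp (-(a + b)) := by
    rw [Real.sinh_eq, neg_sub, Real.exp_sub, Real.exp_sub, Real.exp_neg, Real.exp_add]
    field_simp
    nlinarith
  refine ⟨a - b, by rw [hc, hs], ?_⟩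
  rw [hc, Real.log_exp, coinFun, ha, hb]
  ring

/-- Since log cosh t = t - log 2 + log(1 + e^{-2t}), large t gives the value log 2 in the limit at u
= 1 and arbitrarily large values for u > 1, where no optimal finite tilt exists. -/
lemma le_mul_sub_log_cosh {t u : ℝ} :
    t * (u - 1) + Real.log 2 - Real.exp (-(2 * t)) ≤ t * u - Real.log (Real.cosh t) := by
  have h : Real.cosh t = Real.exp t * (1 + Real.exp (-(2 * t))) / 2 := by
    rw [Real.cosh_eq, mul_add, ← Real.exp_add]; ring_nf
  have hpos : (0 : ℝ) < 1 + Real.exp (-(2 * t)) := by positivity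
  rw [h, Real.log_div (by positivity) two_ne_zero, Real.log_mul (by positivity) hpos.ne',
    Real.log_exp]
  have := Real.log_le_sub_one_of_pos hpos
  linarith

lemma exists_lt_mul_sub_log_cosh_of_nonneg {u c : ℝ} (hu : 0 ≤ u)
    (hc : (c : EReal) < (coinRate u : ℝ≥0∞)) :
    ∃ t : ℝ, c < t * u - Real.log (Real.cosh t) := by
  rcases lt_trichotomy u 1 with h | h | h
  · have hu' : |u| < 1 := by rwa [abs_of_nonneg hu]
    obtain ⟨t, -, ht⟩ := exists_tilt hu'
    have hnn : 0 ≤ coinFun u := by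
      have h2 := Real.convexOn_mul_log.2 (Set.mem_Ici.2 (by linarith : 0 ≤ 1 + u))
        (Set.mem_Ici.2 (by linarith : 0 ≤ 1 - u)) (by norm_num : (0 : ℝ) ≤ 1 / 2)
        (by norm_num : (0 : ℝ) ≤ 1 / 2) (by norm_num)
      have e : (1 / 2 : ℝ) * (1 + u) + 1 / 2 * (1 - u) = 1 := by ring
      simp only [smul_eq_mul, e, Real.log_one, mul_zero] at h2
      simp only [coinFun]; linarith
    rw [coinRate_of_abs_le hu'.le, EReal.coe_ennreal_ofReal, EReal.coe_lt_coe_iff,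
      max_eq_left hnn] at hc
    exact ⟨t, by rwa [ht]⟩
  · subst h
    rw [coinRate_of_abs_le (by simp), EReal.coe_ennreal_ofReal, EReal.coe_lt_coe_iff] at hc
    have : coinFun 1 = Real.log 2 := by simp [coinFun]; norm_num
    rw [this, max_eq_left (Real.log_nonneg one_le_two)] at hc
    have h1 : Tendsto (fun t : ℝ => Real.exp (-(2 * t))) atTop (𝓝 0) :=
      Real.tendsto_exp_neg_atTop_nhds_zero.comp (tendsto_id.const_mul_atTop zero_lt_two)
    obtain ⟨t, ht⟩ := (h1.eventually_lt_const (sub_pos.2 hc)).exists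
    refine ⟨t, lt_of_lt_of_le ?_ le_mul_sub_log_cosh⟩
    linarith
  · obtain ⟨t, ht⟩ := exists_gt (max 0 ((c + 1) / (u - 1)))
    have ht0 : 0 < t := (le_max_left _ _).trans_lt ht
    have ht1 : (c + 1) / (u - 1) < t := (le_max_right _ _).trans_lt ht
    rw [div_lt_iff₀ (by linarith)] at ht1
    refine ⟨t, lt_of_lt_of_le ?_ le_mul_sub_log_cosh⟩
    have h1 : Real.exp (-(2 * t)) ≤ 1 := by
      rw [Real.exp_le_one_iff]; linarith
    have h2 := Real.log_nonneg (one_le_two (α := ℝ))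
    linarith

lemma exists_lt_mul_sub_log_cosh {u c : ℝ} (hc : (c : EReal) < (coinRate u : ℝ≥0∞)) :
    ∃ t : ℝ, c < t * u - Real.log (Real.cosh t) := by
  rcases le_total 0 u with hu | hu
  · exact exists_lt_mul_sub_log_cosh_of_nonneg hu hc
  · rw [← coinRate_neg] at hc
    obtain ⟨t, ht⟩ := exists_lt_mul_sub_log_cosh_of_nonneg (neg_nonneg.2 hu) hc
    exact ⟨-t, by rw [Real.cosh_neg]; linarith⟩

/-! ## Large deviations of the magnetisation of a block -/

open Classical in
/-- The configurations of a block of `k` spins with magnetisation (per `N` sites) in `E`. -/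
noncomputable def blockEvent (k N : ℕ) (E : Set ℝ) : Finset (Fin k → ℤˣ) :=
  {τ | blockSum τ / (N : ℝ) ∈ E}

/-- The probability that the magnetisation of a block of `k` fair spins lies in `E`. -/
noncomputable def blockProb (k N : ℕ) (E : Set ℝ) : ℝ :=
  ((blockEvent k N E).card : ℝ) / 2 ^ k

lemma mem_blockEvent {k N : ℕ} {E : Set ℝ} {τ : Fin k → ℤˣ} :
    τ ∈ blockEvent k N E ↔ blockSum τ / (N : ℝ) ∈ E := by
  simp [blockEvent]

lemma blockProb_mono {k N : ℕ} {E F : Set ℝ} (h : E ⊆ F) : blockProb k N E ≤ blockProb k N F := by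
  unfold blockProb
  gcongr
  intro τ hτ
  rw [mem_blockEvent] at hτ ⊢
  exact h hτ

lemma blockProb_le_one (k N : ℕ) (E : Set ℝ) : blockProb k N E ≤ 1 := by
  unfold blockProb
  rw [div_le_one (by positivity)]
  have := Finset.card_le_univ (blockEvent k N E)
  rw [Fintype.card_fun, Fintype.card_fin, Fintype.card_units_int] at this
  exact_mod_cast this

lemma sum_exp_mul_blockSum (k : ℕ) (t : ℝ) :
    ∑ τ : Fin k → ℤˣ, Real.exp (t * blockSum τ) = (2 * Real.cosh t) ^ k := by
  have h : ∀ τ : Fin k → ℤˣ, Real.exp (t * blockSum τ) =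
      ∏ j, Real.exp (t * ((τ j : ℤ) : ℝ)) := by
    intro τ
    rw [← Real.exp_sum, blockSum, Finset.mul_sum]
  simp_rw [h]
  have h2 : ∑ e : ℤˣ, Real.exp (t * ((e : ℤ) : ℝ)) = 2 * Real.cosh t := by
    simp [Real.cosh_eq]; ring
  rw [← h2, Fintype.sum_pow]

/-- Exponential Chebyshev inequality with parameter `s` under the weights tilted by `t`; for `t = 0`
it is the Chernoff bound, for other `t` it controls tails of the tilted law. -/
lemma sum_exp_mul_blockSum_le (k N : ℕ) (hN : 0 < N) (s t a : ℝ) (E : Finset (Fin k → ℤˣ))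
    (hE : ∀ τ ∈ E, a ≤ s * (blockSum τ / N)) :
    ∑ τ ∈ E, Real.exp (t * blockSum τ) ≤
      Real.exp (-(a * N)) * (2 * Real.cosh (t + s)) ^ k := by
  rw [← sum_exp_mul_blockSum, Finset.mul_sum]
  refine (Finset.sum_le_sum fun τ hτ => ?_).trans
    (Finset.sum_le_sum_of_subset_of_nonneg (Finset.subset_univ E) fun _ _ _ => by positivity)
  rw [← Real.exp_add]
  have hN' : (0 : ℝ) < N := by exact_mod_cast hN
  have h := mul_le_mul_of_nonneg_right (hE τ hτ) hN'.le
  have e : s * (blockSum τ / N) * N = s * blockSum τ := by field_simp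
  rw [e] at h
  gcongr
  linarith

lemma blockProb_le_exp {k N : ℕ} (hN : 0 < N) {t a : ℝ} {E : Set ℝ}
    (hE : ∀ y ∈ E, a ≤ t * y) :
    blockProb k N E ≤ Real.exp (k * Real.log (Real.cosh t) - a * N) := by
  have h := sum_exp_mul_blockSum_le k N hN t 0 a (blockEvent k N E)
    fun τ hτ => hE _ (mem_blockEvent.1 hτ)
  simp only [zero_mul, Real.exp_zero, Finset.sum_const, nsmul_eq_mul, mul_one, zero_add] at h
  unfold blockProb
  rw [div_le_iff₀ (by positivity)]
  refine h.trans_eq ?_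
  rw [mul_pow, sub_eq_add_neg, Real.exp_add, Real.exp_nat_mul,
    Real.exp_log (Real.cosh_pos t)]
  ring

section BlockProb

variable {k : ℕ → ℕ} {p : ℝ}

lemma exists_nhds_decaysAtLeast_blockProb (hp : 0 < p)
    (hk : Tendsto (fun N : ℕ => (k N : ℝ) / (N : ℝ)) atTop (𝓝 p)) {y c : ℝ}
    (hc : (c : EReal) < ((ENNReal.ofReal p * coinRate (y / p) : ℝ≥0∞) : EReal)) :
    ∃ U ∈ 𝓝 y, DecaysAtLeast (fun N => ENNReal.ofReal (blockProb (k N) N U)) c := by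
  have hc' : ((c / p : ℝ) : EReal) < (coinRate (y / p) : ℝ≥0∞) := by
    rcases le_or_gt |y / p| 1 with h | h
    · rw [coinRate_of_abs_le h] at hc ⊢
      rw [← ENNReal.ofReal_mul hp.le, EReal.coe_ennreal_ofReal, EReal.coe_lt_coe_iff] at hc
      rw [EReal.coe_ennreal_ofReal, EReal.coe_lt_coe_iff, div_lt_iff₀ hp, max_mul_of_nonneg _ _ hp.le,
        zero_mul, mul_comm]
      exact hc
    · rw [coinRate_of_lt_abs h]
      simp
  obtain ⟨t, ht⟩ := exists_lt_mul_sub_log_cosh hc'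
  have ht' : c < t * y - p * Real.log (Real.cosh t) := by
    rw [div_lt_iff₀ hp] at ht
    refine ht.trans_eq ?_
    field_simp
  obtain ⟨c', hc1, hc2⟩ := exists_between ht'
  have hlim : Tendsto (fun N : ℕ => (k N : ℝ) / (N : ℝ) * Real.log (Real.cosh t)) atTop
      (𝓝 (p * Real.log (Real.cosh t))) := hk.mul_const _
  have hcont : ContinuousAt (fun y' => t * y') y := by fun_prop
  -- The neighbourhood is an open half-line on which the Chernoff bound with the nearly optimal `t`
  -- still gives `c'`; the gap `c' - c` absorbs the error in k/N → p.
  refine ⟨{y' | c' + p * Real.log (Real.cosh t) < t * y'},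
    hcont.eventually_const_lt (by linarith), ?_⟩
  filter_upwards [hlim.eventually_lt_const
    (show _ < p * Real.log (Real.cosh t) + (c' - c) by linarith),
    eventually_gt_atTop 0] with N hN h0
  refine ENNReal.ofReal_le_ofReal ((blockProb_le_exp h0 (t := t)
    (a := c' + p * Real.log (Real.cosh t)) fun y' hy' => le_of_lt hy').trans ?_)
  have hN' : (0 : ℝ) < N := by exact_mod_cast h0
  gcongr
  have h := mul_lt_mul_of_pos_right hN hN'
  have e : (k N : ℝ) / N * Real.log (Real.cosh t) * N = k N * Real.log (Real.cosh t) := by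
    field_simp
  rw [e] at h
  nlinarith

/-- The quotient cosh(t+s)/cosh t = cosh s + u sinh s is the moment generating function of a spin of
mean u; the second-order bound on the exponential makes it at most 1 + us + s². -/
lemma cosh_add_le {t u s : ℝ} (hu : |u| ≤ 1) (ht : Real.sinh t = u * Real.cosh t) (hs : |s| ≤ 1) :
    Real.cosh (t + s) ≤ Real.cosh t * Real.exp (u * s + s ^ 2) := by
  obtain ⟨hu1, hu2⟩ := abs_le.1 hu
  rw [Real.cosh_add, ht, mul_assoc, mul_comm u, mul_assoc, ← mul_add]
  refine mul_le_mul_of_nonneg_left ?_ (Real.cosh_pos t).le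
  have h1 := (abs_le.1 (Real.abs_exp_sub_one_sub_id_le hs)).2
  have h2 := (abs_le.1 (Real.abs_exp_sub_one_sub_id_le (x := -s) (by rwa [abs_neg]))).2
  have h3 := Real.add_one_le_exp (u * s + s ^ 2)
  rw [Real.cosh_eq, Real.sinh_eq]
  nlinarith [mul_le_mul_of_nonneg_left h1 (by linarith : 0 ≤ 1 + u),
    mul_le_mul_of_nonneg_left h2 (by linarith : 0 ≤ 1 - u)]

lemma tendsto_exp_mul_natCast {g : ℕ → ℝ} {a : ℝ} (ha : a < 0) (hg : Tendsto g atTop (𝓝 a)) :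
    Tendsto (fun N : ℕ => Real.exp (g N * N)) atTop (𝓝 0) :=
  Real.tendsto_exp_atBot.comp (hg.neg_mul_atTop ha tendsto_natCast_atTop_atTop)

/-- Under the tilted measure, the magnetisation concentrates. -/
lemma eventually_tilted_tail_le (hp : 0 < p)
    (hk : Tendsto (fun N : ℕ => (k N : ℝ) / (N : ℝ)) atTop (𝓝 p)) {t u δ s : ℝ}
    (hu : |u| ≤ 1) (ht : Real.sinh t = u * Real.cosh t) (hδ : 0 < δ) (hs : |s| = min 1 (δ / (2 * p)))
    (E : (N : ℕ) → Finset (Fin (k N) → ℤˣ))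
    (hE : ∀ N, ∀ τ ∈ E N, s * (u * p) + |s| * δ ≤ s * (blockSum τ / N)) :
    ∀ᶠ N : ℕ in atTop, ∑ τ ∈ E N, Real.exp (t * blockSum τ) ≤
      1 / 4 * (2 * Real.cosh t) ^ k N := by
  have hs1 : |s| ≤ 1 := hs ▸ min_le_left _ _
  have hs2 : |s| ≤ δ / (2 * p) := hs ▸ min_le_right _ _
  have hs0 : 0 < |s| := hs ▸ lt_min one_pos (by positivity)
  -- The terms linear in `u` cancel, leaving p s² - |s| δ, which is at most -|s| δ / 2 by the choice
  -- of |s|.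
  have hneg : p * (u * s + s ^ 2) - (s * (u * p) + |s| * δ) < 0 := by
    rw [le_div_iff₀ (by positivity)] at hs2
    rw [← sq_abs s]
    nlinarith
  have hlim := tendsto_exp_mul_natCast hneg
    ((hk.mul_const (u * s + s ^ 2)).sub_const (s * (u * p) + |s| * δ))
  filter_upwards [hlim.eventually_le_const (show (0 : ℝ) < 1 / 4 by norm_num),
    eventually_gt_atTop 0] with N hN h0
  have hN' : (0 : ℝ) < N := by exact_mod_cast h0
  refine (sum_exp_mul_blockSum_le (k N) N h0 s t _ (E N) (hE N)).trans ?_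
  have h1 : (2 * Real.cosh (t + s)) ^ k N ≤
      (2 * Real.cosh t) ^ k N * Real.exp (k N * (u * s + s ^ 2)) := by
    rw [Real.exp_nat_mul, ← mul_pow]
    have := cosh_add_le hu ht hs1
    have := Real.cosh_pos (t + s)
    refine pow_le_pow_left₀ (by positivity) ?_ _
    linarith
  calc _ ≤ Real.exp (-((s * (u * p) + |s| * δ) * N)) *
        ((2 * Real.cosh t) ^ k N * Real.exp (k N * (u * s + s ^ 2))) := by gcongr
    _ = Real.exp (((k N : ℝ) / N * (u * s + s ^ 2) - (s * (u * p) + |s| * δ)) * N) *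
        (2 * Real.cosh t) ^ k N := by
      rw [mul_left_comm, ← Real.exp_add, mul_comm]
      congr 2
      field_simp
      ring
    _ ≤ _ := by
      have := Real.cosh_pos t
      gcongr

/-- Cramér's lower bound by change of measure: tilted by `t`, the magnetisation concentrates at `y`,
and on the δ-window every weight is at most exp((ty + |t|δ)N), so the window must contain many
configurations. The condition |y| < p ensures that the tilt is finite. -/
lemma decaysAtMost_blockProb (hp : 0 < p)
    (hk : Tendsto (fun N : ℕ => (k N : ℝ) / (N : ℝ)) atTop (𝓝 p)) {y c : ℝ} (hy : |y| < p)
    (hc : ((ENNReal.ofReal p * coinRate (y / p) : ℝ≥0∞) : EReal) < c) {U : Set ℝ} (hU : U ∈ 𝓝 y) :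
    DecaysAtMost (fun N => ENNReal.ofReal (blockProb (k N) N U)) c := by
  obtain ⟨u, hyu⟩ : ∃ u, u = y / p := ⟨_, rfl⟩
  have hyu' : y = u * p := by rw [hyu]; field_simp
  have hu : |u| < 1 := by rwa [hyu, abs_div, abs_of_pos hp, div_lt_one hp]
  obtain ⟨t, ht, htu⟩ := exists_tilt hu
  have hc' : t * y - p * Real.log (Real.cosh t) < c := by
    rw [← hyu, coinRate_of_abs_le hu.le, ← ENNReal.ofReal_mul hp.le, EReal.coe_ennreal_ofReal,
      EReal.coe_lt_coe_iff, ← htu] at hc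
    refine lt_of_le_of_lt (le_of_eq ?_) ((le_max_left _ _).trans_lt hc)
    rw [hyu']; ring
  obtain ⟨δ₀, hδ₀, hδU⟩ := Metric.mem_nhds_iff.1 hU
  obtain ⟨c', hc1, hc2⟩ := exists_between hc'
  obtain ⟨δ, hδ, hδ1, hδ2⟩ : ∃ δ, 0 < δ ∧ δ ≤ δ₀ ∧
      t * y - p * Real.log (Real.cosh t) + |t| * δ ≤ c' := by
    refine ⟨min δ₀ ((c' - (t * y - p * Real.log (Real.cosh t))) / (|t| + 1)),
      lt_min hδ₀ (div_pos (by linarith) (by positivity)), min_le_left _ _, ?_⟩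
    have h1 : |t| * min δ₀ ((c' - (t * y - p * Real.log (Real.cosh t))) / (|t| + 1)) ≤
        (|t| + 1) * ((c' - (t * y - p * Real.log (Real.cosh t))) / (|t| + 1)) :=
      mul_le_mul (by linarith) (min_le_right _ _)
        (le_min hδ₀.le (div_nonneg (by linarith) (by positivity))) (by positivity)
    rw [mul_div_cancel₀ _ (by positivity)] at h1
    linarith
  obtain ⟨s, hs⟩ : ∃ s, s = min 1 (δ / (2 * p)) := ⟨_, rfl⟩
  have hs0 : 0 < s := hs ▸ lt_min one_pos (by positivity)
  have T1 := eventually_tilted_tail_le hp hk hu.le ht hδ (s := s) (by rw [abs_of_pos hs0, hs])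
    (fun N => blockEvent (k N) N (Set.Ici (y + δ))) fun N τ hτ => by
      have : y + δ ≤ blockSum τ / N := mem_blockEvent.1 hτ
      rw [abs_of_pos hs0, ← hyu', ← mul_add]
      gcongr
  have T2 := eventually_tilted_tail_le hp hk hu.le ht hδ (s := -s)
    (by rw [abs_neg, abs_of_pos hs0, hs])
    (fun N => blockEvent (k N) N (Set.Iic (y - δ))) fun N τ hτ => by
      have : blockSum τ / N ≤ y - δ := mem_blockEvent.1 hτ
      rw [abs_neg, abs_of_pos hs0, ← hyu']
      nlinarith
  have hlim : Tendsto (fun N : ℕ => (k N : ℝ) / (N : ℝ) * Real.log (Real.cosh t)) atTop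
      (𝓝 (p * Real.log (Real.cosh t))) := hk.mul_const _
  obtain ⟨c'', hc3, hc4⟩ := exists_between hc2
  -- Each of the two tails carries at most a quarter of the tilted mass, so the window keeps at
  -- least half; this is the factor 2, removed at the end by a small loss of rate.
  have H : DecaysAtMost (fun N => ENNReal.ofReal (2 * blockProb (k N) N U)) c'' := by
    filter_upwards [T1, T2, hlim.eventually_const_lt
      (show p * Real.log (Real.cosh t) - (c'' - c') < _ by linarith),
      eventually_gt_atTop 0] with N h1 h2 h3 h0
    have hN' : (0 : ℝ) < N := by exact_mod_cast h0
    refine ENNReal.ofReal_le_ofReal ?_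
    obtain ⟨E, hE⟩ : ∃ E, E = blockEvent (k N) N (Set.Ioo (y - δ) (y + δ)) := ⟨_, rfl⟩
    have hcover : (2 * Real.cosh t) ^ k N ≤ (∑ τ ∈ E, Real.exp (t * blockSum τ)) +
        ((∑ τ ∈ blockEvent (k N) N (Set.Ici (y + δ)), Real.exp (t * blockSum τ)) +
        ∑ τ ∈ blockEvent (k N) N (Set.Iic (y - δ)), Real.exp (t * blockSum τ)) := by
      rw [← sum_exp_mul_blockSum, hE]
      unfold blockEvent
      rw [Finset.sum_filter, Finset.sum_filter, Finset.sum_filter, ← Finset.sum_add_distrib,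
        ← Finset.sum_add_distrib]
      refine Finset.sum_le_sum fun τ _ => ?_
      simp only [Set.mem_Ioo, Set.mem_Ici, Set.mem_Iic]
      have := Real.exp_pos (t * blockSum τ)
      split_ifs <;> grind
    have hsum : ∑ τ ∈ E, Real.exp (t * blockSum τ) ≤
        (E.card : ℝ) * Real.exp ((t * y + |t| * δ) * N) := by
      rw [← nsmul_eq_mul]
      refine Finset.sum_le_card_nsmul _ _ _ fun τ hτ => ?_
      rw [hE, mem_blockEvent] at hτ
      have h4 : |blockSum τ / N - y| ≤ δ := by
        rw [abs_le]; constructor <;> linarith [hτ.1, hτ.2]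
      have h5 : t * (blockSum τ / N - y) ≤ |t| * δ :=
        (le_abs_self _).trans (by rw [abs_mul]; gcongr)
      have e : t * blockSum τ = t * (blockSum τ / N) * N := by field_simp
      rw [e]
      gcongr
      linarith
    have hcard : (E.card : ℝ) ≤ (blockEvent (k N) N U).card := by
      refine Nat.cast_le.2 (Finset.card_le_card fun τ hτ => ?_)
      rw [hE, mem_blockEvent] at hτ
      refine mem_blockEvent.2 (hδU ?_)
      rw [Metric.mem_ball, Real.dist_eq, abs_lt]
      constructor <;> linarith [hτ.1, hτ.2]
    have hexp : Real.exp (-(c'' * N)) * Real.exp ((t * y + |t| * δ) * N) ≤ Real.cosh t ^ k N := by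
      rw [← Real.exp_log (Real.cosh_pos t), ← Real.exp_nat_mul, ← Real.exp_add]
      gcongr
      have h := mul_lt_mul_of_pos_right h3 hN'
      have e : (k N : ℝ) / N * Real.log (Real.cosh t) * N = k N * Real.log (Real.cosh t) := by
        field_simp
      rw [e] at h
      nlinarith
    have hpos := Real.exp_pos ((t * y + |t| * δ) * N)
    unfold blockProb
    rw [mul_div_assoc', le_div_iff₀ (by positivity)]
    rw [← mul_le_mul_iff_left₀ hpos]
    rw [mul_pow] at h1 h2 hcover
    have h2k : (0 : ℝ) < 2 ^ k N := by positivity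
    have := mul_le_mul_of_nonneg_right hexp h2k.le
    have := mul_le_mul_of_nonneg_right hcard hpos.le
    linarith
  refine (H.half hc4).mono (fun N => ?_) le_rfl
  rw [ENNReal.ofReal_mul zero_le_two, ENNReal.ofReal_ofNat, mul_comm, ENNReal.mul_div_cancel_right]
  all_goals simp

end BlockProb

/-! ## Consequences of the large deviation principle on the line -/

lemma SatisfiesLDP.decaysAtLeast_of_isClosed {X : Type*} [TopologicalSpace X] [MeasurableSpace X]
    {μ : ℕ → Measure X} {J : X → ℝ≥0∞} (h : SatisfiesLDP μ J) {F : Set X} (hF : IsClosed F)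
    {c : ℝ} {e : ℝ≥0∞} (hce : (c : EReal) < e) (he : ∀ x ∈ F, e ≤ J x) :
    DecaysAtLeast (fun N => μ N F) c :=
  DecaysAtLeast.of_limsup (h.upper F hF) <| hce.trans_le <|
    le_iInf₂ fun x hx => EReal.coe_ennreal_le_coe_ennreal_iff.2 (he x hx)

lemma SatisfiesLDP.decaysAtMost_of_mem_nhds {X : Type*} [TopologicalSpace X] [MeasurableSpace X]
    {μ : ℕ → Measure X} {J : X → ℝ≥0∞} (h : SatisfiesLDP μ J) {x : X} {U : Set X} (hU : U ∈ 𝓝 x)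
    {c : ℝ} (hc : (J x : EReal) < c) : DecaysAtMost (fun N => μ N U) c := by
  obtain ⟨G, hGU, hG, hx⟩ := mem_nhds_iff.1 hU
  have : (⨅ y ∈ G, ((J y : ℝ≥0∞) : EReal)) < c := (iInf₂_le x hx).trans_lt hc
  exact (DecaysAtMost.of_liminf (h.lower G hG) this).mono (fun N => measure_mono hGU) le_rfl

section Line

variable {law : ℕ → ProbabilityMeasure ℝ} {J : ℝ → ℝ≥0∞}

lemma SatisfiesLDP.exists_nhds_decaysAtLeast
    (h : SatisfiesLDP (fun N => (law N : Measure ℝ)) J) {x c : ℝ} (hc : (c : EReal) < J x) :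
    ∃ U ∈ 𝓝 x, DecaysAtLeast (fun N => (law N : Measure ℝ) U) c := by
  rcases lt_or_ge c 0 with h0 | h0
  -- For a negative rate the bound is at least 1, hence trivial for probability measures.
  · refine ⟨Set.univ, univ_mem, Eventually.of_forall fun N => ?_⟩
    beta_reduce
    rw [measure_univ, ENNReal.one_le_ofReal, Real.one_le_exp_iff]
    have : (0 : ℝ) ≤ N := N.cast_nonneg
    nlinarith
  · have hc' : ENNReal.ofReal c < J x := by
      rw [← EReal.coe_ennreal_lt_coe_ennreal_iff, EReal.coe_ennreal_ofReal, max_eq_left h0]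
      exact hc
    obtain ⟨e, he1, he2⟩ := exists_between hc'
    obtain ⟨δ, hδ, hδe⟩ := Metric.nhds_basis_closedBall.mem_iff.1 (h.lsc x e he2)
    refine ⟨Metric.closedBall x δ, Metric.closedBall_mem_nhds x hδ,
      h.decaysAtLeast_of_isClosed Metric.isClosed_closedBall (e := e) ?_
        fun y hy => le_of_lt (hδe hy)⟩
    rw [← EReal.coe_ennreal_lt_coe_ennreal_iff, EReal.coe_ennreal_ofReal, max_eq_left h0] at he1
    exact he1

/-- A positive rate at 0 would make some neighbourhood of 0 exponentially unlikely, whereas weak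
convergence to δ_0 sends the mass of its interior to 1. -/
lemma SatisfiesLDP.rate_zero (h : SatisfiesLDP (fun N => (law N : Measure ℝ)) J)
    (hlaw : Tendsto law atTop (𝓝 (diracProba (0 : ℝ)))) : J 0 = 0 := by
  by_contra hne
  have hpos : 0 < J 0 := pos_iff_ne_zero.2 hne
  obtain ⟨e, he0, he1, he2⟩ := ENNReal.lt_iff_exists_real_btwn.1 hpos
  have he1' : 0 < e := by simpa using he1
  have hlt : (e : EReal) < J 0 := by
    rw [← EReal.coe_ennreal_lt_coe_ennreal_iff, EReal.coe_ennreal_ofReal, max_eq_left he0] at he2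
    exact he2
  obtain ⟨U, hU, hdec⟩ := h.exists_nhds_decaysAtLeast hlt
  obtain ⟨G, hGU, hG, h0⟩ := mem_nhds_iff.1 hU
  have h1 := ProbabilityMeasure.le_liminf_measure_open_of_tendsto hlaw hG
  have h2 : ((diracProba (0 : ℝ) : ProbabilityMeasure ℝ) : Measure ℝ) G = 1 := by
    simp [diracProba, h0]
  rw [h2] at h1
  have h3 : Tendsto (fun N : ℕ => ENNReal.ofReal (Real.exp (-(e * N)))) atTop (𝓝 0) := by
    have := tendsto_exp_mul_natCast (g := fun _ => -e) (neg_lt_zero.2 he1') tendsto_const_nhds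
    simpa [Function.comp_def] using (ENNReal.continuous_ofReal.tendsto 0).comp this
  have h4 := eventually_lt_of_lt_liminf ((show (1 / 2 : ℝ≥0∞) < 1 by
    simp).trans_le h1)
  obtain ⟨N, hN1, hN2, hN3⟩ := (h4.and (hdec.and (h3.eventually_lt_const
    (show (0 : ℝ≥0∞) < 1 / 2 by simp)))).exists
  exact absurd (hN1.trans_le ((measure_mono hGU).trans (hN2.trans hN3.le))) (lt_irrefl _)

lemma ConvexOn.rate_mul_le (hJ : ConvexOn ℝ≥0 Set.univ J) (h0 : J 0 = 0) {θ x : ℝ} (hθ : 0 ≤ θ)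
    (hθ1 : θ ≤ 1) : J (θ * x) ≤ ENNReal.ofReal θ * J x := by
  lift θ to ℝ≥0 using hθ
  have hθ1' : θ ≤ 1 := by exact_mod_cast hθ1
  have := hJ.2 (Set.mem_univ x) (Set.mem_univ 0) (zero_le (a := θ)) (zero_le (a := 1 - θ))
    (add_tsub_cancel_of_le hθ1')
  simp only [h0, smul_zero, add_zero] at this
  rw [ENNReal.ofReal_coe_nnreal]
  exact this

/-- Convexity and J(0) = 0 make J monotone along rays from 0. So a value `e > b` below J at the two
points ±(R+1), which lie outside the bounded level set, bounds J from below on both tails. -/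
lemma SatisfiesLDP.exists_tail_decaysAtLeast
    (h : SatisfiesLDP (fun N => (law N : Measure ℝ)) J) (hJ : ConvexOn ℝ≥0 Set.univ J)
    (h0 : J 0 = 0) {b : ℝ} (hb : 0 ≤ b)
    (hbdd : Bornology.IsBounded {x : ℝ | J x ≤ ENNReal.ofReal b}) :
    ∃ R > 0, ∃ c > b, DecaysAtLeast (fun N => (law N : Measure ℝ) {x | R ≤ |x|}) c := by
  obtain ⟨R, hR, hRb⟩ := hbdd.subset_closedBall_lt 0 0
  have hR1 : 0 < R + 1 := by linarith
  have key : ∀ x : ℝ, |x| = R + 1 → ENNReal.ofReal b < J x := by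
    intro x hx
    by_contra hcon
    have := hRb (show x ∈ {x : ℝ | J x ≤ ENNReal.ofReal b} from not_lt.1 hcon)
    rw [mem_closedBall_zero_iff, Real.norm_eq_abs] at this
    linarith
  obtain ⟨e, he1, he2⟩ := exists_between (lt_min (key (R + 1) (abs_of_pos hR1))
    (key (-(R + 1)) (by rw [abs_neg, abs_of_pos hR1])))
  have hF : ∀ x : ℝ, R + 1 ≤ |x| → e ≤ J x := by
    intro x hx
    have hx0 : 0 < |x| := hR1.trans_le hx
    have h1 : (R + 1) / |x| ≤ 1 := (div_le_one hx0).2 hx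
    have h2 : J ((R + 1) / |x| * x) ≤ J x :=
      (hJ.rate_mul_le h0 (by positivity) h1).trans (mul_le_of_le_one_left (zero_le)
        (by simpa using ENNReal.ofReal_le_ofReal h1))
    refine le_trans ?_ h2
    rcases abs_choice x with hs | hs
    · rw [hs, div_mul_cancel₀ _ (by rw [← hs]; exact hx0.ne')]
      exact (he2.trans_le (min_le_left _ _)).le
    · have : (R + 1) / |x| * x = -(R + 1) := by
        have hxne : x ≠ 0 := abs_pos.1 hx0
        rw [hs]; field_simp
      rw [this]
      exact (he2.trans_le (min_le_right _ _)).le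
  obtain ⟨c, hc0, hc1, hc2⟩ := ENNReal.lt_iff_exists_real_btwn.1 he1
  refine ⟨R + 1, hR1, c, ?_, h.decaysAtLeast_of_isClosed
    (isClosed_le continuous_const continuous_abs) (e := e) ?_ hF⟩
  · exact (ENNReal.ofReal_lt_ofReal_iff_of_nonneg hb).1 hc1
  · rw [← EReal.coe_ennreal_lt_coe_ennreal_iff, EReal.coe_ennreal_ofReal, max_eq_left hc0] at hc2
    exact hc2

end Line

/-! ## Borel–Cantelli -/

lemma ae_eventually_notMem_of_decaysAtLeast {Ω : Type*} [MeasurableSpace Ω] {P : Measure Ω}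
    {s : ℕ → Set Ω} {η : ℝ} (hη : 0 < η) (h : DecaysAtLeast (fun N => P (s N)) η) :
    ∀ᵐ ω ∂P, ∀ᶠ N in atTop, ω ∉ s N := by
  obtain ⟨N₀, hN₀⟩ := eventually_atTop.1 h
  have hsum : ∑' N, P (s (N + N₀)) ≠ ∞ := by
    have h1 : Summable fun N : ℕ => Real.exp (-(η * N)) := by
      have := Real.summable_exp_nat_mul_iff.2 (neg_lt_zero.2 hη)
      refine this.congr fun N => ?_
      congr 1; ring
    refine ne_top_of_le_ne_top h1.tsum_ofReal_ne_top (ENNReal.tsum_le_tsum fun N => ?_)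
    refine (hN₀ _ (Nat.le_add_left _ _)).trans (ENNReal.ofReal_le_ofReal ?_)
    gcongr
    exact Nat.le_add_right _ _
  filter_upwards [ae_eventually_notMem hsum] with ω hω
  rw [eventually_atTop] at hω ⊢
  obtain ⟨N₁, hN₁⟩ := hω
  refine ⟨N₁ + N₀, fun N hN => ?_⟩
  have := hN₁ (N - N₀) (by omega)
  rwa [Nat.sub_add_cancel (by omega)] at this

/-! ## Moments of the number of configurations with prescribed energies -/

/-- The sequences with all entries in `A`. -/
noncomputable def seqsIn {n : ℕ} (A : Finset (Fin n)) : Finset (OrdSeq n) := {t | ∀ j, t.2 j ∈ A}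

lemma mem_seqsIn {n : ℕ} {A : Finset (Fin n)} {t : OrdSeq n} :
    t ∈ seqsIn A ↔ ∀ j, t.2 j ∈ A := by simp [seqsIn]

lemma seqsIn_univ {n : ℕ} : seqsIn (Finset.univ : Finset (Fin n)) = Finset.univ := by
  ext t; simp [mem_seqsIn]

lemma seqsIn_empty {n : ℕ} : seqsIn (∅ : Finset (Fin n)) = ∅ := by
  ext t
  simp [mem_seqsIn]

section Moments

variable {n : ℕ} {k : Fin n → ℕ} {Ω : Type*}
  {law : OrdSeq n → Measure ℝ} {ξ : (s : OrdSeq n) → SubConfig k s → Ω → ℝ}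
  {Δ : OrdSeq n → Set ℝ}

/-- The event that all `ξ(t, σ(t))`, with `t` having its entries in `A`, lie in `Δ t`. -/
def energyEvent (ξ : (s : OrdSeq n) → SubConfig k s → Ω → ℝ) (Δ : OrdSeq n → Set ℝ)
    (A : Finset (Fin n)) (σ : Config k) : Set Ω :=
  {ω | ∀ t ∈ seqsIn A, ξ t (subConfig σ t) ω ∈ Δ t}

/-- The probability of `energyEvent`. -/
noncomputable def energyProb (law : OrdSeq n → Measure ℝ) (Δ : OrdSeq n → Set ℝ)
    (A : Finset (Fin n)) : ℝ≥0∞ :=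
  ∏ t ∈ seqsIn A, law t (Δ t)

/-- The indices of the random variables that enter `energyEvent`. -/
noncomputable def energyIndices (A : Finset (Fin n)) (σ : Config k) : Finset (Σ s : OrdSeq n, SubConfig k s) :=
  (seqsIn A).image fun t => ⟨t, subConfig σ t⟩

lemma prod_energyIndices (A : Finset (Fin n)) (σ : Config k) (f : OrdSeq n → ℝ≥0∞) :
    ∏ q ∈ energyIndices A σ, f q.1 = ∏ t ∈ seqsIn A, f t := by
  rw [energyIndices, Finset.prod_image]
  intro t _ t' _ h
  exact congrArg Sigma.fst h

lemma energyEvent_eq_biInter (A : Finset (Fin n)) (σ : Config k) :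
    energyEvent ξ Δ A σ = ⋂ q ∈ energyIndices A σ, ξ q.1 q.2 ⁻¹' Δ q.1 := by
  ext ω
  rw [energyIndices, Finset.set_biInter_finset_image]
  simp [energyEvent]

/-- A variable is shared exactly when σ(t) = σ'(t), that is, when every entry of t is a block on
which the two configurations agree. The whole correlation structure is in this identity. -/
lemma energyIndices_inter (σ σ' : Config k) :
    energyIndices Finset.univ σ ∩ energyIndices Finset.univ σ' =
      energyIndices (Finset.univ.filter fun i => σ i = σ' i) σ := by
  ext ⟨t, τ⟩
  simp only [energyIndices, seqsIn_univ, Finset.mem_inter, Finset.mem_image, Finset.mem_univ,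
    true_and, Sigma.mk.injEq, mem_seqsIn, Finset.mem_filter]
  constructor
  · rintro ⟨⟨t₁, h, h₁⟩, ⟨t₂, h', h₂⟩⟩
    subst h h'
    rw [heq_eq_eq] at h₁ h₂
    exact ⟨t₂, fun j => congrFun (h₁.trans h₂.symm) j, rfl, heq_of_eq h₁⟩
  · rintro ⟨t₁, hj, h, h₁⟩
    subst h
    rw [heq_eq_eq] at h₁
    refine ⟨⟨t₁, rfl, heq_of_eq h₁⟩, ⟨t₁, rfl, heq_of_eq ?_⟩⟩
    rw [← h₁]
    funext j
    exact (hj j).symm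

lemma energyEvent_congr {A : Finset (Fin n)} {σ σ' : Config k} (h : ∀ i ∈ A, σ i = σ' i) :
    energyEvent ξ Δ A σ = energyEvent ξ Δ A σ' := by
  ext ω
  refine forall₂_congr fun t ht => ?_
  rw [mem_seqsIn] at ht
  have : subConfig σ t = subConfig σ' t := funext fun j => h _ (ht j)
  rw [this]

variable [MeasurableSpace Ω] {P : Measure Ω}

lemma measure_biInter_energy (hξ : ∀ s τ, HasLaw (ξ s τ) (law s) P)
    (hind : iIndepFun (fun q : (Σ s : OrdSeq n, SubConfig k s) => ξ q.1 q.2) P)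
    (hΔ : ∀ s, MeasurableSet (Δ s)) (Q : Finset (Σ s : OrdSeq n, SubConfig k s)) :
    P (⋂ q ∈ Q, ξ q.1 q.2 ⁻¹' Δ q.1) = ∏ q ∈ Q, law q.1 (Δ q.1) := by
  rw [hind.measure_inter_preimage_eq_mul Q (sets := fun q => Δ q.1) fun q _ => hΔ q.1]
  refine Finset.prod_congr rfl fun q _ => ?_
  rw [← (hξ q.1 q.2).map_eq, Measure.map_apply_of_aemeasurable (hξ q.1 q.2).aemeasurable (hΔ _)]

lemma measure_energyEvent (hξ : ∀ s τ, HasLaw (ξ s τ) (law s) P)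
    (hind : iIndepFun (fun q : (Σ s : OrdSeq n, SubConfig k s) => ξ q.1 q.2) P)
    (hΔ : ∀ s, MeasurableSet (Δ s)) (A : Finset (Fin n)) (σ : Config k) :
    P (energyEvent ξ Δ A σ) = energyProb law Δ A := by
  rw [energyEvent_eq_biInter, measure_biInter_energy hξ hind hΔ,
    prod_energyIndices A σ fun t => law t (Δ t), energyProb]

/-- By independence the joint probability is a product over the union of the two index sets;
multiplying by the product over the intersection gives the product of both. The multiplicative form
avoids division by a possibly zero probability. -/
lemma measure_energyEvent_inter (hξ : ∀ s τ, HasLaw (ξ s τ) (law s) P)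
    (hind : iIndepFun (fun q : (Σ s : OrdSeq n, SubConfig k s) => ξ q.1 q.2) P)
    (hΔ : ∀ s, MeasurableSet (Δ s)) (σ σ' : Config k) :
    P (energyEvent ξ Δ Finset.univ σ ∩ energyEvent ξ Δ Finset.univ σ') *
      energyProb law Δ (Finset.univ.filter fun i => σ i = σ' i) =
      energyProb law Δ Finset.univ ^ 2 := by
  rw [energyEvent_eq_biInter, energyEvent_eq_biInter, ← Finset.set_biInter_inter,
    measure_biInter_energy hξ hind hΔ, energyProb,
    ← prod_energyIndices _ σ fun t => law t (Δ t), ← energyIndices_inter,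
    Finset.prod_union_inter, prod_energyIndices _ σ fun t => law t (Δ t),
    prod_energyIndices _ σ' fun t => law t (Δ t), sq, energyProb]

lemma nullMeasurableSet_energyEvent (hξ : ∀ s τ, HasLaw (ξ s τ) (law s) P)
    (hΔ : ∀ s, MeasurableSet (Δ s)) (A : Finset (Fin n)) (σ : Config k) :
    NullMeasurableSet (energyEvent ξ Δ A σ) P := by
  rw [energyEvent_eq_biInter]
  exact Finset.nullMeasurableSet_biInter _ fun q _ =>
    (hξ q.1 q.2).aemeasurable.nullMeasurableSet_preimage (hΔ q.1)

/-- Union bound over the restrictions of configurations to `A`. -/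
lemma measure_exists_energyEvent_le (hξ : ∀ s τ, HasLaw (ξ s τ) (law s) P)
    (hind : iIndepFun (fun q : (Σ s : OrdSeq n, SubConfig k s) => ξ q.1 q.2) P)
    (hΔ : ∀ s, MeasurableSet (Δ s)) (A : Finset (Fin n))
    (a : (i : Fin n) → Finset (Fin (k i) → ℤˣ)) :
    P {ω | ∃ σ : Config k, (∀ i ∈ A, σ i ∈ a i) ∧ ω ∈ energyEvent ξ Δ A σ} ≤
      (∏ i ∈ A, ((a i).card : ℝ≥0∞)) * energyProb law Δ A := by
  classical
  -- Blocks outside `A` are frozen to the all-ones configuration, so each restriction to `A` is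
  -- counted once.
  obtain ⟨C, hC⟩ : ∃ C : Finset (Config k),
      C = Fintype.piFinset fun i => if i ∈ A then a i else {fun _ => 1} := ⟨_, rfl⟩
  have hcard : (C.card : ℝ≥0∞) = ∏ i ∈ A, ((a i).card : ℝ≥0∞) := by
    rw [hC, Fintype.card_piFinset, Nat.cast_prod, ← Finset.prod_subset (Finset.subset_univ A)]
    · exact Finset.prod_congr rfl fun i hi => by rw [if_pos hi]
    · intro i _ hi
      simp [hi]
  have hsub : {ω | ∃ σ : Config k, (∀ i ∈ A, σ i ∈ a i) ∧ ω ∈ energyEvent ξ Δ A σ} ⊆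
      ⋃ σ ∈ C, energyEvent ξ Δ A σ := by
    rintro ω ⟨σ, hσ, hω⟩
    refine Set.mem_iUnion₂.2 ⟨fun i => if i ∈ A then σ i else fun _ => 1, ?_, ?_⟩
    · rw [hC, Fintype.mem_piFinset]
      intro i
      by_cases hi : i ∈ A <;> simp [hi, hσ]
    · rwa [energyEvent_congr (σ' := σ)]
      intro i hi
      simp [hi]
  refine (measure_mono hsub).trans ((measure_biUnion_finset_le _ _).trans_eq ?_)
  simp_rw [measure_energyEvent hξ hind hΔ A]
  rw [Finset.sum_const, nsmul_eq_mul, hcard]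

/-- The number of configurations with all blocks in `a` and all energies in `Δ`. -/
noncomputable def energyCount (ξ : (s : OrdSeq n) → SubConfig k s → Ω → ℝ)
    (Δ : OrdSeq n → Set ℝ) (a : (i : Fin n) → Finset (Fin (k i) → ℤˣ)) (ω : Ω) : ℝ≥0∞ :=
  ∑ σ ∈ Fintype.piFinset a, (energyEvent ξ Δ Finset.univ σ).indicator 1 ω

lemma measure_le_energyCount_le (hξ : ∀ s τ, HasLaw (ξ s τ) (law s) P)
    (hind : iIndepFun (fun q : (Σ s : OrdSeq n, SubConfig k s) => ξ q.1 q.2) P)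
    (hΔ : ∀ s, MeasurableSet (Δ s)) (a : (i : Fin n) → Finset (Fin (k i) → ℤˣ))
    {ε : ℝ≥0∞} (hε : ε ≠ 0) (hε' : ε ≠ ⊤) :
    P {ω | ε ≤ energyCount ξ Δ a ω} ≤
      (∏ i, ((a i).card : ℝ≥0∞)) * energyProb law Δ Finset.univ / ε := by
  have hm : ∀ σ : Config k,
      AEMeasurable ((energyEvent ξ Δ Finset.univ σ).indicator (1 : Ω → ℝ≥0∞)) P := fun σ =>
    aemeasurable_const.indicator₀ (nullMeasurableSet_energyEvent hξ hΔ _ σ)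
  refine (meas_ge_le_lintegral_div (Finset.aemeasurable_fun_sum _ fun σ _ => hm σ) hε hε').trans_eq ?_
  rw [lintegral_finsetSum' _ fun σ _ => hm σ]
  simp_rw [lintegral_indicator_one₀ (nullMeasurableSet_energyEvent hξ hΔ _ _),
    measure_energyEvent hξ hind hΔ]
  rw [Finset.sum_const, nsmul_eq_mul, Fintype.card_piFinset, Nat.cast_prod]

end Moments

/-! ## The second moment -/

lemma card_filter_piFinset_mul_prod {ι : Type*} [Fintype ι] [DecidableEq ι] {κ : ι → Type*}
    [∀ i, DecidableEq (κ i)] (a : (i : ι) → Finset (κ i)) (B : Finset ι) {σ : (i : ι) → κ i}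
    (hσ : σ ∈ Fintype.piFinset a) :
    ((Fintype.piFinset a).filter fun σ' => ∀ i ∈ B, σ i = σ' i).card * ∏ i ∈ B, (a i).card =
      ∏ i, (a i).card := by
  rw [Fintype.mem_piFinset] at hσ
  have h : ((Fintype.piFinset a).filter fun σ' => ∀ i ∈ B, σ i = σ' i) =
      Fintype.piFinset fun i => if i ∈ B then {σ i} else a i := by
    ext σ'
    simp only [Finset.mem_filter, Fintype.mem_piFinset]
    constructor
    · rintro ⟨h1, h2⟩ i
      by_cases hi : i ∈ B
      · simp [hi, h2 i hi]
      · simp [hi, h1 i]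
    · intro h
      refine ⟨fun i => ?_, fun i hi => ?_⟩
      · by_cases hi : i ∈ B
        · have := h i
          simp only [hi, if_true, Finset.mem_singleton] at this
          rw [this]; exact hσ i
        · simpa [hi] using h i
      · have := h i
        simp only [hi, if_true, Finset.mem_singleton] at this
        exact this.symm
  rw [h, Fintype.card_piFinset, ← Finset.prod_mul_prod_compl B fun i => (a i).card,
    ← Finset.prod_mul_prod_compl B]
  have h1 : ∏ i ∈ B, (if i ∈ B then {σ i} else a i).card = 1 :=
    Finset.prod_eq_one fun i hi => by simp [hi]
  have h2 : ∏ i ∈ Bᶜ, (if i ∈ B then {σ i} else a i).card = ∏ i ∈ Bᶜ, (a i).card :=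
    Finset.prod_congr rfl fun i hi => by rw [if_neg (Finset.mem_compl.1 hi)]
  rw [h1, h2, one_mul, mul_comm]

lemma integral_indicator_one_of_nullMeasurableSet {Ω : Type*} [MeasurableSpace Ω] {P : Measure Ω}
    {s : Set Ω} (hs : NullMeasurableSet s P) : ∫ ω, s.indicator (1 : Ω → ℝ) ω ∂P = P.real s := by
  rw [integral_indicator₀ hs]
  simp

section Moments

variable {n : ℕ} {k : Fin n → ℕ} {Ω : Type*} [MeasurableSpace Ω] {P : Measure Ω}
  [IsProbabilityMeasure P]
  {law : OrdSeq n → Measure ℝ} {ξ : (s : OrdSeq n) → SubConfig k s → Ω → ℝ}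
  {Δ : OrdSeq n → Set ℝ}

lemma energyProb_le_one (hξ : ∀ s τ, HasLaw (ξ s τ) (law s) P)
    (hind : iIndepFun (fun q : (Σ s : OrdSeq n, SubConfig k s) => ξ q.1 q.2) P)
    (hΔ : ∀ s, MeasurableSet (Δ s)) (A : Finset (Fin n)) : energyProb law Δ A ≤ 1 := by
  rw [← measure_energyEvent hξ hind hΔ A fun _ _ => 1]
  exact prob_le_one

lemma memLp_indicator_energyEvent (hξ : ∀ s τ, HasLaw (ξ s τ) (law s) P)
    (hΔ : ∀ s, MeasurableSet (Δ s)) (A : Finset (Fin n)) (σ : Config k) :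
    MemLp ((energyEvent ξ Δ A σ).indicator (1 : Ω → ℝ)) 2 P := by
  refine MemLp.of_bound ((aemeasurable_const.indicator₀
    (nullMeasurableSet_energyEvent hξ hΔ _ σ)).aestronglyMeasurable) 1 (ae_of_all _ fun ω => ?_)
  by_cases h : ω ∈ energyEvent ξ Δ A σ <;> simp [h]

lemma covariance_indicator_energyEvent (hξ : ∀ s τ, HasLaw (ξ s τ) (law s) P)
    (hind : iIndepFun (fun q : (Σ s : OrdSeq n, SubConfig k s) => ξ q.1 q.2) P)
    (hΔ : ∀ s, MeasurableSet (Δ s)) (σ σ' : Config k) :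
    covariance ((energyEvent ξ Δ Finset.univ σ).indicator (1 : Ω → ℝ))
      ((energyEvent ξ Δ Finset.univ σ').indicator (1 : Ω → ℝ)) P =
    P.real (energyEvent ξ Δ Finset.univ σ ∩ energyEvent ξ Δ Finset.univ σ') -
      (energyProb law Δ Finset.univ).toReal ^ 2 := by
  rw [covariance_eq_sub (memLp_indicator_energyEvent hξ hΔ _ σ)
    (memLp_indicator_energyEvent hξ hΔ _ σ'), ← Set.inter_indicator_one]
  rw [integral_indicator_one_of_nullMeasurableSet (nullMeasurableSet_energyEvent hξ hΔ _ _),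
    integral_indicator_one_of_nullMeasurableSet (nullMeasurableSet_energyEvent hξ hΔ _ _),
    integral_indicator_one_of_nullMeasurableSet ((nullMeasurableSet_energyEvent hξ hΔ _ _).inter
      (nullMeasurableSet_energyEvent hξ hΔ _ _))]
  simp only [Measure.real, measure_energyEvent hξ hind hΔ]
  ring

/-- Concentration of the number of configurations with prescribed energies: if the expected number
of restrictions to each non-empty `B` is at least `r`, then the count is unlikely to be less than
half of its mean. -/
lemma measure_energyCount_lt_le (hξ : ∀ s τ, HasLaw (ξ s τ) (law s) P)
    (hind : iIndepFun (fun q : (Σ s : OrdSeq n, SubConfig k s) => ξ q.1 q.2) P)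
    (hΔ : ∀ s, MeasurableSet (Δ s)) (a : (i : Fin n) → Finset (Fin (k i) → ℤˣ))
    {r : ℝ} (hr : 0 < r) (h : ∀ B : Finset (Fin n), B.Nonempty →
      ENNReal.ofReal r ≤ (∏ i ∈ B, ((a i).card : ℝ≥0∞)) * energyProb law Δ B) :
    P {ω | energyCount ξ Δ a ω <
      (∏ i, ((a i).card : ℝ≥0∞)) * energyProb law Δ Finset.univ / 2} ≤
      ENNReal.ofReal (4 * 2 ^ n / r) := by
  obtain ⟨L, hL⟩ : ∃ L : Finset (Fin n) → ℝ, L = fun B => (energyProb law Δ B).toReal := ⟨_, rfl⟩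
  have hLB : ∀ B, energyProb law Δ B = ENNReal.ofReal (L B) := fun B => by
    rw [hL, ENNReal.ofReal_toReal]
    exact ne_top_of_le_ne_top ENNReal.one_ne_top (energyProb_le_one hξ hind hΔ B)
  have hL0 : ∀ B, 0 ≤ L B := fun B => by rw [hL]; exact ENNReal.toReal_nonneg
  obtain ⟨c, hc⟩ : ∃ c : Fin n → ℝ, c = fun i => ((a i).card : ℝ) := ⟨_, rfl⟩
  have hc0 : ∀ i, 0 ≤ c i := fun i => by simp only [hc]; exact Nat.cast_nonneg _
  have hcard : ∀ B : Finset (Fin n), (∏ i ∈ B, ((a i).card : ℝ≥0∞)) =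
      ENNReal.ofReal (∏ i ∈ B, c i) := fun B => by
    rw [ENNReal.ofReal_prod_of_nonneg fun i _ => hc0 i]
    exact Finset.prod_congr rfl fun i _ => by rw [hc, ENNReal.ofReal_natCast]
  have hr' : ∀ B : Finset (Fin n), B.Nonempty → r ≤ (∏ i ∈ B, c i) * L B := fun B hB => by
    have := h B hB
    rw [hcard, hLB, ← ENNReal.ofReal_mul (Finset.prod_nonneg fun i _ => hc0 i)] at this
    exact (ENNReal.ofReal_le_ofReal_iff (mul_nonneg (Finset.prod_nonneg fun i _ => hc0 i)
      (hL0 B))).1 this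
  obtain ⟨m, hm⟩ : ∃ m, m = (∏ i, c i) * L Finset.univ := ⟨_, rfl⟩
  have hm0 : 0 ≤ m := hm ▸ mul_nonneg (Finset.prod_nonneg fun i _ => hc0 i) (hL0 _)
  rw [hcard, hLB, ← ENNReal.ofReal_mul (Finset.prod_nonneg fun i _ => hc0 i), ← hm]
  rcases hm0.eq_or_lt with hm0 | hmpos
  · simp [← hm0]
  obtain ⟨Y, hY⟩ : ∃ Y : Config k → Ω → ℝ,
      Y = fun σ => (energyEvent ξ Δ Finset.univ σ).indicator (1 : Ω → ℝ) := ⟨_, rfl⟩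
  obtain ⟨C, hC⟩ : ∃ C : Finset (Config k), C = Fintype.piFinset a := ⟨_, rfl⟩
  obtain ⟨X, hX⟩ : ∃ X : Ω → ℝ, X = fun ω => ∑ σ ∈ C, Y σ ω := ⟨_, rfl⟩
  have hYm : ∀ σ ∈ C, MemLp (Y σ) 2 P := fun σ _ => by
    rw [hY]; exact memLp_indicator_energyEvent hξ hΔ _ σ
  have hXm : MemLp X 2 P := by rw [hX]; exact memLp_finsetSum _ hYm
  have hCc : (C.card : ℝ) = ∏ i, c i := by
    rw [hC, Fintype.card_piFinset, Nat.cast_prod, hc]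
  have hmean : P[X] = m := by
    rw [hX, integral_finsetSum _ fun σ hσ => (hYm σ hσ).integrable (by norm_num)]
    have : ∀ σ ∈ C, ∫ ω, Y σ ω ∂P = L Finset.univ := fun σ _ => by
      simp only [hY]
      rw [integral_indicator_one_of_nullMeasurableSet (nullMeasurableSet_energyEvent hξ hΔ _ _), Measure.real,
        measure_energyEvent hξ hind hΔ, hL]
    rw [Finset.sum_congr rfl this, Finset.sum_const, nsmul_eq_mul, hCc, hm]
  have hcount : ∀ ω, energyCount ξ Δ a ω = ENNReal.ofReal (X ω) := fun ω => by
    rw [hX, energyCount, ← hC, ENNReal.ofReal_sum_of_nonneg]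
    · refine Finset.sum_congr rfl fun σ _ => ?_
      rw [hY]
      by_cases hω : ω ∈ energyEvent ξ Δ Finset.univ σ <;> simp [hω]
    · intro σ _
      rw [hY]
      exact Set.indicator_nonneg (fun _ _ => zero_le_one) _
  -- If the agreement set is empty the covariance is zero. Otherwise its own term in the sum
  -- suffices, by `hr'` and the joint probability formula; the remaining terms are non-negative and
  -- make the sum over pairs easy to evaluate.
  have hcov : ∀ σ ∈ C, ∀ σ' ∈ C, covariance (Y σ) (Y σ') P ≤
      ∑ B ∈ Finset.univ.filter fun B : Finset (Fin n) => B.Nonempty,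
        (if ∀ i ∈ B, σ i = σ' i then 1 else 0) * (L Finset.univ ^ 2 * (∏ i ∈ B, c i) / r) := by
    intro σ _ σ' _
    obtain ⟨B, hB⟩ : ∃ B : Finset (Fin n), B = Finset.univ.filter fun i => σ i = σ' i := ⟨_, rfl⟩
    have hnn : ∀ B' ∈ Finset.univ.filter fun B : Finset (Fin n) => B.Nonempty,
        0 ≤ (if ∀ i ∈ B', σ i = σ' i then (1 : ℝ) else 0) *
          (L Finset.univ ^ 2 * (∏ i ∈ B', c i) / r) := fun B' _ => by
      have := Finset.prod_nonneg (s := B') fun i _ => hc0 i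
      split_ifs <;> positivity
    have hpair := congrArg ENNReal.toReal (measure_energyEvent_inter hξ hind hΔ σ σ')
    rw [← hB, ENNReal.toReal_mul, ENNReal.toReal_pow] at hpair
    simp only [hY]
    rw [covariance_indicator_energyEvent hξ hind hΔ, Measure.real]
    rw [hL] at hr' ⊢
    rcases B.eq_empty_or_nonempty with hBe | hBne
    · rw [hBe, energyProb, seqsIn_empty, Finset.prod_empty, ENNReal.toReal_one, mul_one] at hpair
      rw [hpair, sub_self]
      rw [hL] at hnn
      exact Finset.sum_nonneg hnn
    · have h1 := hr' B hBne
      rw [hL] at hnn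
      refine le_trans ?_ (Finset.single_le_sum hnn (Finset.mem_filter.2 ⟨Finset.mem_univ B, hBne⟩))
      rw [if_pos fun i hi => by rw [hB, Finset.mem_filter] at hi; exact hi.2, one_mul,
        le_div_iff₀ hr, ← hpair]
      have h2 : (0 : ℝ) ≤ (P (energyEvent ξ Δ Finset.univ σ ∩
        energyEvent ξ Δ Finset.univ σ')).toReal := ENNReal.toReal_nonneg
      have h3 := mul_le_mul_of_nonneg_left h1 h2
      have h4 : 0 ≤ (P (energyEvent ξ Δ Finset.univ σ ∩
        energyEvent ξ Δ Finset.univ σ')).toReal * (energyProb law Δ B).toReal * r := by positivity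
      linarith
  -- For fixed σ and B, the number of σ' agreeing with σ on B, times the product of the
  -- cardinalities over B, is the full product. All dependence on B cancels, and at most 2^n sets
  -- remain.
  have hvar : variance X P ≤ 2 ^ n * m ^ 2 / r := by
    rw [hX, variance_fun_sum' hYm]
    calc _ ≤ ∑ σ ∈ C, ∑ σ' ∈ C, ∑ B ∈ Finset.univ.filter fun B : Finset (Fin n) => B.Nonempty,
          (if ∀ i ∈ B, σ i = σ' i then 1 else 0) * (L Finset.univ ^ 2 * (∏ i ∈ B, c i) / r) :=
          Finset.sum_le_sum fun σ hσ => Finset.sum_le_sum fun σ' hσ' => hcov σ hσ σ' hσ'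
      _ = ∑ σ ∈ C, ∑ B ∈ Finset.univ.filter fun B : Finset (Fin n) => B.Nonempty,
          (∏ i, c i) * (L Finset.univ ^ 2 / r) := by
        refine Finset.sum_congr rfl fun σ hσ => ?_
        rw [Finset.sum_comm]
        refine Finset.sum_congr rfl fun B _ => ?_
        rw [← Finset.sum_mul, Finset.sum_boole]
        have := congrArg (Nat.cast (R := ℝ)) (card_filter_piFinset_mul_prod a B (hC ▸ hσ))
        rw [Nat.cast_mul, Nat.cast_prod, Nat.cast_prod] at this
        rw [hC, hc, mul_div_right_comm, mul_comm (L Finset.univ ^ 2 / r), ← mul_assoc]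
        refine congrArg (· * (L Finset.univ ^ 2 / r)) (Eq.trans ?_ this)
        congr
      _ = (Finset.univ.filter fun B : Finset (Fin n) => B.Nonempty).card * (m ^ 2 / r) := by
        rw [Finset.sum_const, Finset.sum_const, nsmul_eq_mul, nsmul_eq_mul, hCc, hm]
        ring
      _ ≤ 2 ^ n * m ^ 2 / r := by
        rw [mul_div_assoc]
        gcongr
        have := Finset.card_le_univ (Finset.univ.filter fun B : Finset (Fin n) => B.Nonempty)
        rw [Fintype.card_finset, Fintype.card_fin] at this
        exact_mod_cast this
  have hsub : {ω | energyCount ξ Δ a ω < ENNReal.ofReal m / 2} ⊆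
      {ω | m / 2 ≤ |X ω - P[X]|} := by
    intro ω hω
    rw [Set.mem_ofPred_eq, hcount, ← ENNReal.ofReal_ofNat 2, ← ENNReal.ofReal_div_of_pos zero_lt_two,
      ENNReal.ofReal_lt_ofReal_iff (by positivity)] at hω
    rw [Set.mem_ofPred_eq, hmean, le_abs]
    right; linarith
  refine (measure_mono hsub).trans ((meas_ge_le_variance_div_sq hXm (half_pos hmpos)).trans
    (ENNReal.ofReal_le_ofReal ?_))
  rw [div_le_iff₀ (by positivity)]
  refine hvar.trans_eq ?_
  field_simp
  ring

end Moments

/-! ## Almost sure bounds for the empirical measures of boxes -/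

/-- A product set in `ℝ^S × ℝ^n`. -/
def box {n : ℕ} (Δ : OrdSeq n → Set ℝ) (E : Fin n → Set ℝ) :
    Set ((OrdSeq n → ℝ) × (Fin n → ℝ)) :=
  Set.univ.pi Δ ×ˢ Set.univ.pi E

/-- The probability that a random configuration restricted to `A` has its magnetisations in `E`
and its energies in `Δ`. -/
noncomputable def boxProb {n : ℕ} (law : OrdSeq n → Measure ℝ) (k : Fin n → ℕ) (N : ℕ)
    (Δ : OrdSeq n → Set ℝ) (E : Fin n → Set ℝ) (A : Finset (Fin n)) : ℝ≥0∞ :=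
  energyProb law Δ A * ∏ i ∈ A, ENNReal.ofReal (blockProb (k i) N (E i))

lemma natCast_card_blockEvent (k N : ℕ) (E : Set ℝ) :
    ((blockEvent k N E).card : ℝ≥0∞) = 2 ^ k * ENNReal.ofReal (blockProb k N E) := by
  have h : (2 : ℝ≥0∞) ^ k = ENNReal.ofReal (2 ^ k) := by
    rw [ENNReal.ofReal_pow zero_le_two, ENNReal.ofReal_ofNat]
  rw [h, ← ENNReal.ofReal_mul (by positivity), blockProb, mul_div_cancel₀ _ (by positivity),
    ENNReal.ofReal_natCast]

lemma prod_card_mul_energyProb {n : ℕ} (law : OrdSeq n → Measure ℝ) (k : Fin n → ℕ) (N : ℕ)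
    (Δ : OrdSeq n → Set ℝ) (E : Fin n → Set ℝ) (A : Finset (Fin n)) :
    (∏ i ∈ A, ((blockEvent (k i) N (E i)).card : ℝ≥0∞)) * energyProb law Δ A =
      2 ^ (∑ i ∈ A, k i) * boxProb law k N Δ E A := by
  simp_rw [natCast_card_blockEvent]
  rw [Finset.prod_mul_distrib, Finset.prod_pow_eq_pow_sum, boxProb]
  ring

lemma measurableSet_box {n : ℕ} {Δ : OrdSeq n → Set ℝ} {E : Fin n → Set ℝ}
    (hΔ : ∀ s, MeasurableSet (Δ s)) (hE : ∀ i, MeasurableSet (E i)) : MeasurableSet (box Δ E) :=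
  (MeasurableSet.univ_pi hΔ).prod (MeasurableSet.univ_pi hE)

lemma empiricalMeasure_box {n : ℕ} {Ω : Type*} (N : ℕ) (k : Fin n → ℕ)
    (ξ : (s : OrdSeq n) → SubConfig k s → Ω → ℝ) (ω : Ω) {Δ : OrdSeq n → Set ℝ}
    {E : Fin n → Set ℝ} (hΔ : ∀ s, MeasurableSet (Δ s)) (hE : ∀ i, MeasurableSet (E i)) :
    empiricalMeasure N k (fun s τ => ξ s τ ω) (box Δ E) =
      ((2 : ℝ≥0∞) ^ N)⁻¹ * energyCount ξ Δ (fun i => blockEvent (k i) N (E i)) ω := by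
  rw [empiricalMeasure, Measure.smul_apply, Measure.finsetSum_apply, smul_eq_mul, energyCount]
  congr 1
  rw [← Finset.sum_subset (Finset.subset_univ (Fintype.piFinset _))]
  · refine Finset.sum_congr rfl fun σ hσ => ?_
    rw [Measure.dirac_apply' _ (measurableSet_box hΔ hE)]
    rw [Fintype.mem_piFinset] at hσ
    have hσ' : ∀ i, blockSum (σ i) / (N : ℝ) ∈ E i := fun i => mem_blockEvent.1 (hσ i)
    by_cases h : ∀ s, ξ s (subConfig σ s) ω ∈ Δ s
    · rw [Set.indicator_of_mem (by simpa [box] using ⟨h, hσ'⟩),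
        Set.indicator_of_mem (by intro t _; exact h t), Pi.one_apply, Pi.one_apply]
    · rw [Set.indicator_of_notMem, Set.indicator_of_notMem]
      · intro h'
        exact h fun s => h' s (by simp [seqsIn_univ])
      · intro h'
        exact h fun s => h'.1 s (Set.mem_univ s)
  · intro σ _ hσ
    rw [Measure.dirac_apply' _ (measurableSet_box hΔ hE), Set.indicator_of_notMem]
    intro h'
    exact hσ (Fintype.mem_piFinset.2 fun i => mem_blockEvent.2 (h'.2 i (Set.mem_univ i)))

section Sequence

variable {n : ℕ} {k : ℕ → Fin n → ℕ} {p : Fin n → ℝ}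

lemma tendsto_sum_mul_log_two
    (hkp : ∀ i, Tendsto (fun N : ℕ => (k N i : ℝ) / (N : ℝ)) atTop (𝓝 (p i)))
    (A : Finset (Fin n)) :
    Tendsto (fun N : ℕ => (∑ i ∈ A, (k N i : ℝ)) / N * Real.log 2) atTop
      (𝓝 (∑ i ∈ A, p i * Real.log 2)) := by
  simp_rw [Finset.sum_div, Finset.sum_mul]
  exact tendsto_finsetSum _ fun i _ => (hkp i).mul_const _

lemma two_pow_sum_eq (N : ℕ) (hN : 0 < N) (A : Finset (Fin n)) :
    (2 : ℝ≥0∞) ^ (∑ i ∈ A, k N i) =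
      ENNReal.ofReal (Real.exp ((∑ i ∈ A, (k N i : ℝ)) / N * Real.log 2 * N)) := by
  have hN' : (N : ℝ) ≠ 0 := by exact_mod_cast hN.ne'
  have e : (∑ i ∈ A, (k N i : ℝ)) / N * Real.log 2 * N =
      ((∑ i ∈ A, k N i : ℕ) : ℝ) * Real.log 2 := by
    rw [Nat.cast_sum]; field_simp
  rw [e, Real.exp_nat_mul, Real.exp_log zero_lt_two, ENNReal.ofReal_pow zero_le_two,
    ENNReal.ofReal_ofNat]

/-- Growth is recorded as decay at a negative rate, so it combines with `boxProb` through
`DecaysAtLeast.mul`. -/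
lemma decaysAtLeast_two_pow
    (hkp : ∀ i, Tendsto (fun N : ℕ => (k N i : ℝ) / (N : ℝ)) atTop (𝓝 (p i)))
    (A : Finset (Fin n)) {c : ℝ} (hc : ∑ i ∈ A, p i * Real.log 2 < c) :
    DecaysAtLeast (fun N => 2 ^ (∑ i ∈ A, k N i)) (-c) := by
  filter_upwards [(tendsto_sum_mul_log_two hkp A).eventually_lt_const hc,
    eventually_gt_atTop 0] with N h h0
  rw [two_pow_sum_eq N h0]
  gcongr
  rw [neg_mul, neg_neg]
  gcongr

lemma decaysAtMost_two_pow
    (hkp : ∀ i, Tendsto (fun N : ℕ => (k N i : ℝ) / (N : ℝ)) atTop (𝓝 (p i)))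
    (A : Finset (Fin n)) {c : ℝ} (hc : c < ∑ i ∈ A, p i * Real.log 2) :
    DecaysAtMost (fun N => 2 ^ (∑ i ∈ A, k N i)) (-c) := by
  filter_upwards [(tendsto_sum_mul_log_two hkp A).eventually_const_lt hc,
    eventually_gt_atTop 0] with N h h0
  rw [two_pow_sum_eq N h0]
  gcongr
  rw [neg_mul, neg_neg]
  gcongr

variable {Ω : Type*} [MeasurableSpace Ω] {P : Measure Ω}
  {law : OrdSeq n → ℕ → Measure ℝ}
  {ξ : (N : ℕ) → (s : OrdSeq n) → SubConfig (k N) s → Ω → ℝ}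
  {Δ : OrdSeq n → Set ℝ} {E : Fin n → Set ℝ}

/-- First moment method on the blocks of `A` alone: when the rate of `boxProb` exceeds the entropy
∑_{i∈A} p_i log 2, the union bound is summable in `N`. -/
lemma ae_eventually_forall_notMem_energyEvent
    (hkp : ∀ i, Tendsto (fun N : ℕ => (k N i : ℝ) / (N : ℝ)) atTop (𝓝 (p i)))
    (hξ : ∀ N, n ≤ N → ∀ s τ, HasLaw (ξ N s τ) (law s N) P)
    (hind : ∀ N, n ≤ N →
      iIndepFun (fun q : (Σ s : OrdSeq n, SubConfig (k N) s) => ξ N q.1 q.2) P)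
    (hΔ : ∀ s, MeasurableSet (Δ s)) {A : Finset (Fin n)} {c : ℝ}
    (hc : ∑ i ∈ A, p i * Real.log 2 < c)
    (h : DecaysAtLeast (fun N => boxProb (fun s => law s N) (k N) N Δ E A) c) :
    ∀ᵐ ω ∂P, ∀ᶠ N in atTop, ∀ σ : Config (k N), (∀ i ∈ A, blockSum (σ i) / (N : ℝ) ∈ E i) →
      ω ∉ energyEvent (ξ N) Δ A σ := by
  obtain ⟨d, hd1, hd2⟩ := exists_between hc
  have h1 := (decaysAtLeast_two_pow hkp A hd1).mul h
  have h2 : DecaysAtLeast (fun N => P {ω | ∃ σ : Config (k N),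
      (∀ i ∈ A, σ i ∈ blockEvent (k N i) N (E i)) ∧ ω ∈ energyEvent (ξ N) Δ A σ}) (-d + c) := by
    filter_upwards [h1, eventually_ge_atTop n] with N h1 hN
    refine (measure_exists_energyEvent_le (hξ N hN) (hind N hN) hΔ A _).trans ?_
    rw [prod_card_mul_energyProb]
    exact h1
  filter_upwards [ae_eventually_notMem_of_decaysAtLeast (by linarith) h2] with ω hω
  filter_upwards [hω] with N hN σ hσ hmem
  exact hN ⟨σ, fun i hi => mem_blockEvent.2 (hσ i hi), hmem⟩

/-- Markov's inequality at the threshold e^{-cN} fails with probability at most e^{-(d-c)N}, which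
is summable. -/
lemma ae_decaysAtLeast_empiricalMeasure_box (hk : ∀ N, n ≤ N → ∑ i, k N i = N)
    (hξ : ∀ N, n ≤ N → ∀ s τ, HasLaw (ξ N s τ) (law s N) P)
    (hind : ∀ N, n ≤ N →
      iIndepFun (fun q : (Σ s : OrdSeq n, SubConfig (k N) s) => ξ N q.1 q.2) P)
    (hΔ : ∀ s, MeasurableSet (Δ s)) (hE : ∀ i, MeasurableSet (E i)) {c d : ℝ} (hcd : c < d)
    (h : DecaysAtLeast (fun N => boxProb (fun s => law s N) (k N) N Δ E Finset.univ) d) :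
    ∀ᵐ ω ∂P, DecaysAtLeast
      (fun N => empiricalMeasure N (k N) (fun s τ => ξ N s τ ω) (box Δ E)) c := by
  have h2 : DecaysAtLeast (fun N => P {ω | 2 ^ N * ENNReal.ofReal (Real.exp (-(c * N))) ≤
      energyCount (ξ N) Δ (fun i => blockEvent (k N i) N (E i)) ω}) (d - c) := by
    filter_upwards [h, eventually_ge_atTop n] with N h hN
    have hpos : ENNReal.ofReal (Real.exp (-(c * N))) ≠ 0 := by
      simpa using Real.exp_pos _
    refine (measure_le_energyCount_le (hξ N hN) (hind N hN) hΔ _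
      (mul_ne_zero (by simp) hpos) (ENNReal.mul_ne_top (by simp) ENNReal.ofReal_ne_top)).trans ?_
    rw [prod_card_mul_energyProb, hk N hN,
      ENNReal.mul_div_mul_left _ _ (by simp) (by simp)]
    refine (ENNReal.div_le_div_right h _).trans_eq ?_
    rw [← ENNReal.ofReal_div_of_pos (Real.exp_pos _), ← Real.exp_sub]
    congr 2; ring
  filter_upwards [ae_eventually_notMem_of_decaysAtLeast (by linarith) h2] with ω hω
  filter_upwards [hω] with N hN
  rw [not_le] at hN
  rw [empiricalMeasure_box N (k N) (ξ N) ω hΔ hE, mul_comm, ← div_eq_mul_inv]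
  exact ENNReal.div_le_of_le_mul' hN.le

variable [IsProbabilityMeasure P]

lemma ae_eventually_boxProb_le_empiricalMeasure_box (hk : ∀ N, n ≤ N → ∑ i, k N i = N)
    (hξ : ∀ N, n ≤ N → ∀ s τ, HasLaw (ξ N s τ) (law s N) P)
    (hind : ∀ N, n ≤ N →
      iIndepFun (fun q : (Σ s : OrdSeq n, SubConfig (k N) s) => ξ N q.1 q.2) P)
    (hΔ : ∀ s, MeasurableSet (Δ s)) (hE : ∀ i, MeasurableSet (E i)) {η : ℝ} (hη : 0 < η)
    (h : ∀ B : Finset (Fin n), B.Nonempty → DecaysAtMost (fun N => 2 ^ (∑ i ∈ B, k N i) *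
      boxProb (fun s => law s N) (k N) N Δ E B) (-η)) :
    ∀ᵐ ω ∂P, ∀ᶠ N in atTop, boxProb (fun s => law s N) (k N) N Δ E Finset.univ / 2 ≤
      empiricalMeasure N (k N) (fun s τ => ξ N s τ ω) (box Δ E) := by
  have h1 : ∀ᶠ N : ℕ in atTop, ∀ B : Finset (Fin n), B.Nonempty →
      ENNReal.ofReal (Real.exp (η * N)) ≤ 2 ^ (∑ i ∈ B, k N i) *
        boxProb (fun s => law s N) (k N) N Δ E B := by
    rw [eventually_all]
    intro B
    by_cases hB : B.Nonempty
    · filter_upwards [h B hB] with N hN _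
      simpa using hN
    · exact Eventually.of_forall fun N h => absurd h hB
  -- Half of the rate η absorbs the Chebyshev constant; the other half gives summability.
  have hlim : Tendsto (fun N : ℕ => 4 * 2 ^ n * Real.exp (-(η / 2) * N)) atTop (𝓝 0) := by
    simpa using (tendsto_exp_mul_natCast (g := fun _ => -(η / 2)) (by linarith)
      tendsto_const_nhds).const_mul (4 * 2 ^ n)
  have h2 : DecaysAtLeast (fun N => P {ω |
      energyCount (ξ N) Δ (fun i => blockEvent (k N i) N (E i)) ω <
      (∏ i, ((blockEvent (k N i) N (E i)).card : ℝ≥0∞)) *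
        energyProb (fun s => law s N) Δ Finset.univ / 2}) (η / 2) := by
    filter_upwards [h1, eventually_ge_atTop n,
      hlim.eventually_le_const zero_lt_one] with N h1 hN h3
    refine (measure_energyCount_lt_le (hξ N hN) (hind N hN) hΔ
      (fun i => blockEvent (k N i) N (E i)) (Real.exp_pos (η * N))
      fun B hB => by rw [prod_card_mul_energyProb]; exact h1 B hB).trans
      (ENNReal.ofReal_le_ofReal ?_)
    rw [div_le_iff₀ (Real.exp_pos _), ← Real.exp_add]
    have e : -(η / 2 * N) + η * N = η / 2 * N := by ring
    rw [neg_mul, Real.exp_neg, ← div_eq_mul_inv, div_le_one (Real.exp_pos _)] at h3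
    rwa [e]
  filter_upwards [ae_eventually_notMem_of_decaysAtLeast (by linarith) h2] with ω hω
  filter_upwards [hω, eventually_ge_atTop n] with N hN hn
  rw [not_lt, prod_card_mul_energyProb, hk N hn, mul_div_assoc] at hN
  rw [empiricalMeasure_box N (k N) (ξ N) ω hΔ hE, ← ENNReal.mul_le_iff_le_inv (by simp) (by simp)]
  exact hN

end Sequence

/-! ## The rate function of the model -/

section Rate

variable {n : ℕ} {I : OrdSeq n → ℝ → ℝ≥0∞} {p : Fin n → ℝ}

lemma partialRate_eq (A : Finset (Fin n)) (z : (OrdSeq n → ℝ) × (Fin n → ℝ)) :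
    partialRate I p A z = ∑ t ∈ seqsIn A, I t (z.1 t) +
      ∑ i ∈ A, ENNReal.ofReal (p i) * coinRate (z.2 i / p i) := rfl

lemma modelRate_of_mem {z : (OrdSeq n → ℝ) × (Fin n → ℝ)} (hz : z ∈ rateSupport I p) :
    modelRate I p z = partialRate I p Finset.univ z := by
  rw [modelRate, if_pos hz, partialRate_eq, seqsIn_univ]

lemma modelRate_of_notMem {z : (OrdSeq n → ℝ) × (Fin n → ℝ)} (hz : z ∉ rateSupport I p) :
    modelRate I p z = ⊤ := if_neg hz

lemma lowerSemicontinuous_partialRate (hI : ∀ s, LowerSemicontinuous (I s))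
    (A : Finset (Fin n)) : LowerSemicontinuous (partialRate I p A) := by
  have h1 : LowerSemicontinuous fun z : (OrdSeq n → ℝ) × (Fin n → ℝ) =>
      ∑ t ∈ seqsIn A, I t (z.1 t) :=
    lowerSemicontinuous_sum fun t _ => LowerSemicontinuous.comp (hI t) (by fun_prop)
  have h2 : LowerSemicontinuous fun z : (OrdSeq n → ℝ) × (Fin n → ℝ) =>
      ∑ i ∈ A, ENNReal.ofReal (p i) * coinRate (z.2 i / p i) := by
    refine lowerSemicontinuous_sum fun i _ => ?_
    have h3 : LowerSemicontinuous fun z : (OrdSeq n → ℝ) × (Fin n → ℝ) => coinRate (z.2 i / p i) :=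
      LowerSemicontinuous.comp lowerSemicontinuous_coinRate (by fun_prop)
    exact Continuous.comp_lowerSemicontinuous (ENNReal.continuous_const_mul ENNReal.ofReal_ne_top)
      h3 fun x y hxy => mul_le_mul_right hxy _
  exact h1.add h2

lemma isClosed_rateSupport (hI : ∀ s, LowerSemicontinuous (I s)) :
    IsClosed (rateSupport I p) := by
  have : rateSupport I p = ⋂ A : Finset (Fin n),
      {z | partialRate I p A z ≤ ENNReal.ofReal (∑ i ∈ A, p i * Real.log 2)} := by
    ext z; simp [rateSupport]
  rw [this]
  exact isClosed_iInter fun A => (lowerSemicontinuous_partialRate hI A).isClosed_preimage _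

lemma lowerSemicontinuous_modelRate (hI : ∀ s, LowerSemicontinuous (I s)) :
    LowerSemicontinuous (modelRate I p) := by
  intro z c hc
  by_cases hz : z ∈ rateSupport I p
  · rw [modelRate_of_mem hz] at hc
    filter_upwards [lowerSemicontinuous_partialRate hI _ z c hc] with w hw
    by_cases hw' : w ∈ rateSupport I p
    · rwa [modelRate_of_mem hw']
    · rw [modelRate_of_notMem hw']; exact hw.trans_le le_top
  · filter_upwards [(isClosed_rateSupport hI).isOpen_compl.mem_nhds hz] with w hw
    rw [modelRate_of_notMem hw]
    rwa [modelRate_of_notMem hz] at hc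

lemma abs_le_of_partialRate_ne_top (hp : ∀ i, 0 < p i) {A : Finset (Fin n)}
    {z : (OrdSeq n → ℝ) × (Fin n → ℝ)} (h : partialRate I p A z ≠ ⊤) {i : Fin n} (hi : i ∈ A) :
    |z.2 i| ≤ p i := by
  by_contra! hcon
  refine h (top_unique ?_)
  have h1 : coinRate (z.2 i / p i) = ⊤ := coinRate_of_lt_abs (by
    rwa [abs_div, abs_of_pos (hp i), one_lt_div (hp i)])
  have h2 : ENNReal.ofReal (p i) * coinRate (z.2 i / p i) = ⊤ := by
    rw [h1, ENNReal.mul_top (by simpa using hp i)]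
  rw [partialRate_eq, ← h2]
  exact (Finset.single_le_sum (f := fun i => ENNReal.ofReal (p i) * coinRate (z.2 i / p i))
    (fun _ _ => zero_le) hi).trans le_add_self

/-- The inequality defining D for the set of entries of `s` thereby bounds I_s(x_s), by log 2 once ∑
p_i = 1; this is where the level log 2 comes from. -/
lemma rate_le_partialRate (z : (OrdSeq n → ℝ) × (Fin n → ℝ)) (s : OrdSeq n) :
    I s (z.1 s) ≤ partialRate I p (Finset.univ.image s.2) z := by
  rw [partialRate_eq]
  exact (Finset.single_le_sum (f := fun t => I t (z.1 t)) (fun _ _ => zero_le)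
    (mem_seqsIn.2 fun j => Finset.mem_image_of_mem _ (Finset.mem_univ j))).trans le_self_add

lemma partialRate_smul_le (hI : ∀ s, ConvexOn ℝ≥0 Set.univ (I s)) (h0 : ∀ s, I s 0 = 0)
    (A : Finset (Fin n)) (z : (OrdSeq n → ℝ) × (Fin n → ℝ)) {θ : ℝ} (hθ : 0 < θ) (hθ1 : θ ≤ 1) :
    partialRate I p A (θ • z) ≤ ENNReal.ofReal θ * partialRate I p A z := by
  rw [partialRate_eq, partialRate_eq, mul_add, Finset.mul_sum, Finset.mul_sum]
  refine add_le_add (Finset.sum_le_sum fun t _ => (hI t).rate_mul_le (h0 t) hθ.le hθ1)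
    (Finset.sum_le_sum fun i _ => ?_)
  rw [mul_left_comm]
  refine mul_le_mul_right ?_ _
  have : (θ • z).2 i / p i = θ * (z.2 i / p i) := by
    simp [mul_div_assoc]
  rw [this]
  exact coinRate_mul_le hθ hθ1

lemma sum_mul_log_two_le (hp : ∀ i, 0 < p i) (hsum : ∑ i, p i = 1) (A : Finset (Fin n)) :
    ∑ i ∈ A, p i * Real.log 2 ≤ Real.log 2 := by
  rw [← Finset.sum_mul]
  refine mul_le_of_le_one_left (Real.log_nonneg one_le_two) ?_
  rw [← hsum]
  exact Finset.sum_le_sum_of_subset_of_nonneg (Finset.subset_univ A) fun i _ _ => (hp i).le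

lemma isCompact_modelRate_le (hp : ∀ i, 0 < p i) (hsum : ∑ i, p i = 1)
    (hI : ∀ s, LowerSemicontinuous (I s))
    (hbdd : ∀ s, Bornology.IsBounded {x : ℝ | I s x ≤ ENNReal.ofReal (Real.log 2)}) (c : ℝ≥0) :
    IsCompact {z | modelRate I p z ≤ (c : ℝ≥0∞)} := by
  choose R hR using fun s => (hbdd s).subset_closedBall (0 : ℝ)
  have hK : IsCompact ((Set.univ.pi fun s : OrdSeq n => Metric.closedBall (0 : ℝ) (R s)) ×ˢ
      (Set.univ.pi fun i : Fin n => Metric.closedBall (0 : ℝ) (p i))) :=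
    (isCompact_univ_pi fun s => isCompact_closedBall _ _).prod
      (isCompact_univ_pi fun i => isCompact_closedBall _ _)
  refine hK.of_isClosed_subset ((lowerSemicontinuous_modelRate hI).isClosed_preimage _) ?_
  intro z hz
  have hzD : z ∈ rateSupport I p := by
    by_contra h
    have hz' : modelRate I p z ≤ c := hz
    rw [modelRate_of_notMem h] at hz'
    simp at hz'
  refine ⟨fun s _ => hR s ?_, fun i _ => ?_⟩
  · exact (rate_le_partialRate z s).trans ((hzD _).trans
      (ENNReal.ofReal_le_ofReal (sum_mul_log_two_le hp hsum _)))
  · rw [mem_closedBall_zero_iff, Real.norm_eq_abs]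
    exact abs_le_of_partialRate_ne_top hp (ne_top_of_le_ne_top ENNReal.ofReal_ne_top
      (hzD Finset.univ)) (Finset.mem_univ i)

end Rate

/-! ## Exponential bounds for boxes -/

section BoxProb

variable {n : ℕ} {I : OrdSeq n → ℝ → ℝ≥0∞} {p : Fin n → ℝ} {k : ℕ → Fin n → ℕ}
  {law : OrdSeq n → ℕ → ProbabilityMeasure ℝ}

lemma boxProb_mono {law : OrdSeq n → Measure ℝ} {k : Fin n → ℕ} {N : ℕ}
    {Δ Δ' : OrdSeq n → Set ℝ} {E E' : Fin n → Set ℝ} (hΔ : ∀ s, Δ s ⊆ Δ' s)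
    (hE : ∀ i, E i ⊆ E' i) (A : Finset (Fin n)) :
    boxProb law k N Δ E A ≤ boxProb law k N Δ' E' A :=
  mul_le_mul' (Finset.prod_le_prod' fun t _ => measure_mono (hΔ t))
    (Finset.prod_le_prod' fun i _ => ENNReal.ofReal_le_ofReal (blockProb_mono (hE i)))

lemma exists_nhds_decaysAtLeast_boxProb (hp : ∀ i, 0 < p i)
    (hkp : ∀ i, Tendsto (fun N : ℕ => (k N i : ℝ) / (N : ℝ)) atTop (𝓝 (p i)))
    (hLDP : ∀ s, SatisfiesLDP (fun N => (law s N : Measure ℝ)) (I s))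
    {A : Finset (Fin n)} {z : (OrdSeq n → ℝ) × (Fin n → ℝ)} {c : ℝ}
    (hc : (c : EReal) < (partialRate I p A z : ℝ≥0∞)) :
    ∃ Δ : OrdSeq n → Set ℝ, ∃ E : Fin n → Set ℝ, (∀ s, Δ s ∈ 𝓝 (z.1 s)) ∧
      (∀ i, E i ∈ 𝓝 (z.2 i)) ∧ ∃ d, c < d ∧
      DecaysAtLeast (fun N => boxProb (fun s => (law s N : Measure ℝ)) (k N) N Δ E A) d := by
  rw [partialRate_eq] at hc
  obtain ⟨x, y, hx, hy, hxy⟩ := exists_real_lt_add hc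
  obtain ⟨b, hb, hb'⟩ := exists_real_lt_sum _ _ hx
  obtain ⟨e, he, he'⟩ := exists_real_lt_sum _ _ hy
  choose Δ hΔ hΔ' using fun s => (hLDP s).exists_nhds_decaysAtLeast (hb s)
  choose E hE hE' using fun i => exists_nhds_decaysAtLeast_blockProb (hp i) (hkp i) (he i)
  refine ⟨Δ, E, hΔ, hE, ∑ t ∈ seqsIn A, b t + ∑ i ∈ A, e i, by linarith, ?_⟩
  exact (DecaysAtLeast.prod fun t _ => hΔ' t).mul (DecaysAtLeast.prod fun i _ => hE' i)

lemma decaysAtMost_boxProb (hp : ∀ i, 0 < p i)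
    (hkp : ∀ i, Tendsto (fun N : ℕ => (k N i : ℝ) / (N : ℝ)) atTop (𝓝 (p i)))
    (hLDP : ∀ s, SatisfiesLDP (fun N => (law s N : Measure ℝ)) (I s))
    {A : Finset (Fin n)} {z : (OrdSeq n → ℝ) × (Fin n → ℝ)} (hz : ∀ i, |z.2 i| < p i)
    {Δ : OrdSeq n → Set ℝ} {E : Fin n → Set ℝ} (hΔ : ∀ s, Δ s ∈ 𝓝 (z.1 s))
    (hE : ∀ i, E i ∈ 𝓝 (z.2 i)) {c : ℝ} (hc : ((partialRate I p A z : ℝ≥0∞) : EReal) < c) :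
    DecaysAtMost (fun N => boxProb (fun s => (law s N : Measure ℝ)) (k N) N Δ E A) c := by
  rw [partialRate_eq] at hc
  obtain ⟨x, y, hx, hy, hxy⟩ := exists_real_add_lt hc
  obtain ⟨b, hb, hb'⟩ := exists_real_sum_lt _ _ hx
  obtain ⟨e, he, he'⟩ := exists_real_sum_lt _ _ hy
  exact ((DecaysAtMost.prod fun t ht => (hLDP t).decaysAtMost_of_mem_nhds (hΔ t) (hb t ht)).mul
    (DecaysAtMost.prod fun i hi => decaysAtMost_blockProb (hp i) (hkp i) (hz i) (he i hi)
      (hE i))).mono (fun _ => le_rfl) (by linarith)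

end BoxProb

/-! ## From boxes to the large deviation principle -/

/-- The open interval with the given rational endpoints. -/
def ratIoo (q : ℚ × ℚ) : Set ℝ := Set.Ioo (q.1 : ℝ) q.2

lemma isOpen_ratIoo (q : ℚ × ℚ) : IsOpen (ratIoo q) := isOpen_Ioo

lemma measurableSet_ratIoo (q : ℚ × ℚ) : MeasurableSet (ratIoo q) := measurableSet_Ioo

lemma exists_ratIoo_subset {x : ℝ} {U : Set ℝ} (hU : U ∈ 𝓝 x) :
    ∃ q : ℚ × ℚ, ratIoo q ∈ 𝓝 x ∧ ratIoo q ⊆ U := by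
  obtain ⟨l, u, ⟨hl, hu⟩, hsub⟩ := mem_nhds_iff_exists_Ioo_subset.1 hU
  obtain ⟨q, hq1, hq2⟩ := exists_rat_btwn hl
  obtain ⟨r, hr1, hr2⟩ := exists_rat_btwn hu
  exact ⟨(q, r), (isOpen_ratIoo _).mem_nhds ⟨hq2, hr1⟩,
    fun y hy => hsub ⟨hq1.trans hy.1, hy.2.trans hr2⟩⟩

lemma box_mem_nhds {n : ℕ} {Δ : OrdSeq n → Set ℝ} {E : Fin n → Set ℝ}
    {z : (OrdSeq n → ℝ) × (Fin n → ℝ)} (hΔ : ∀ s, Δ s ∈ 𝓝 (z.1 s)) (hE : ∀ i, E i ∈ 𝓝 (z.2 i)) :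
    box Δ E ∈ 𝓝 z :=
  prod_mem_nhds (set_pi_mem_nhds Set.finite_univ fun s _ => hΔ s)
    (set_pi_mem_nhds Set.finite_univ fun i _ => hE i)

lemma exists_box_subset {n : ℕ} {z : (OrdSeq n → ℝ) × (Fin n → ℝ)}
    {U : Set ((OrdSeq n → ℝ) × (Fin n → ℝ))} (hU : U ∈ 𝓝 z) :
    ∃ a : OrdSeq n → ℚ × ℚ, ∃ b : Fin n → ℚ × ℚ, (∀ s, ratIoo (a s) ∈ 𝓝 (z.1 s)) ∧
      (∀ i, ratIoo (b i) ∈ 𝓝 (z.2 i)) ∧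
      box (fun s => ratIoo (a s)) (fun i => ratIoo (b i)) ⊆ U := by
  obtain ⟨ε, hε, hεU⟩ := Metric.mem_nhds_iff.1 hU
  choose a ha ha' using fun s => exists_ratIoo_subset (Metric.ball_mem_nhds (z.1 s) hε)
  choose b hb hb' using fun i => exists_ratIoo_subset (Metric.ball_mem_nhds (z.2 i) hε)
  refine ⟨a, b, ha, hb, fun w hw => hεU ?_⟩
  rw [Metric.mem_ball, Prod.dist_eq, max_lt_iff, dist_pi_lt_iff hε, dist_pi_lt_iff hε]
  exact ⟨fun s => ha' s (hw.1 s (Set.mem_univ s)), fun i => hb' i (hw.2 i (Set.mem_univ i))⟩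

section Deterministic

variable {n : ℕ} {I : OrdSeq n → ℝ → ℝ≥0∞} {p : Fin n → ℝ} {k : ℕ → Fin n → ℕ}
  {law : OrdSeq n → ℕ → ProbabilityMeasure ℝ}
  {μ : ℕ → Measure ((OrdSeq n → ℝ) × (Fin n → ℝ))}

/-- Inside D the rate comes from the full first moment (`h1`); outside D a violated `A` empties a
whole rational box (`h2`). Both hypotheses are the almost sure statements at a fixed ω. -/
lemma exists_nhds_decaysAtLeast_of_lt_modelRate (hp : ∀ i, 0 < p i)
    (hkp : ∀ i, Tendsto (fun N : ℕ => (k N i : ℝ) / (N : ℝ)) atTop (𝓝 (p i)))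
    (hLDP : ∀ s, SatisfiesLDP (fun N => (law s N : Measure ℝ)) (I s))
    (h1 : ∀ (a : OrdSeq n → ℚ × ℚ) (b : Fin n → ℚ × ℚ) (c d : ℚ), c < d →
      DecaysAtLeast (fun N => boxProb (fun s => (law s N : Measure ℝ)) (k N) N
        (fun s => ratIoo (a s)) (fun i => ratIoo (b i)) Finset.univ) d →
      DecaysAtLeast (fun N => μ N (box (fun s => ratIoo (a s)) (fun i => ratIoo (b i)))) c)
    (h2 : ∀ (a : OrdSeq n → ℚ × ℚ) (b : Fin n → ℚ × ℚ) (A : Finset (Fin n)) (c : ℚ),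
      ∑ i ∈ A, p i * Real.log 2 < c →
      DecaysAtLeast (fun N => boxProb (fun s => (law s N : Measure ℝ)) (k N) N
        (fun s => ratIoo (a s)) (fun i => ratIoo (b i)) A) c →
      ∀ᶠ N in atTop, μ N (box (fun s => ratIoo (a s)) (fun i => ratIoo (b i))) = 0)
    {z : (OrdSeq n → ℝ) × (Fin n → ℝ)} {c : ℝ} (hc : (c : EReal) < (modelRate I p z : ℝ≥0∞)) :
    ∃ t ∈ 𝓝 z, ∃ d, c < d ∧ DecaysAtLeast (fun N => μ N t) d := by
  have key : ∀ (A : Finset (Fin n)) (e : ℝ), (e : EReal) < (partialRate I p A z : ℝ≥0∞) →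
      ∃ (a : OrdSeq n → ℚ × ℚ) (b : Fin n → ℚ × ℚ),
        box (fun s => ratIoo (a s)) (fun i => ratIoo (b i)) ∈ 𝓝 z ∧ ∃ q : ℚ, e < q ∧
        DecaysAtLeast (fun N => boxProb (fun s => (law s N : Measure ℝ)) (k N) N
          (fun s => ratIoo (a s)) (fun i => ratIoo (b i)) A) q := by
    intro A e he
    obtain ⟨Δ, E, hΔ, hE, d, hd, hdec⟩ := exists_nhds_decaysAtLeast_boxProb hp hkp hLDP he
    choose a ha ha' using fun s => exists_ratIoo_subset (hΔ s)
    choose b hb hb' using fun i => exists_ratIoo_subset (hE i)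
    obtain ⟨q, hq1, hq2⟩ := exists_rat_btwn hd
    exact ⟨a, b, box_mem_nhds ha hb, q, hq1,
      hdec.mono (fun N => boxProb_mono ha' hb' A) hq2.le⟩
  by_cases hz : z ∈ rateSupport I p
  · rw [modelRate_of_mem hz] at hc
    obtain ⟨a, b, hbox, q, hq, hdec⟩ := key _ c hc
    obtain ⟨r, hr1, hr2⟩ := exists_rat_btwn hq
    exact ⟨_, hbox, r, hr1, h1 a b r q (by exact_mod_cast hr2) hdec⟩
  · obtain ⟨A, hA⟩ : ∃ A, ENNReal.ofReal (∑ i ∈ A, p i * Real.log 2) < partialRate I p A z := by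
      by_contra! hcon
      exact hz hcon
    have hA' : ((∑ i ∈ A, p i * Real.log 2 : ℝ) : EReal) < (partialRate I p A z : ℝ≥0∞) := by
      rw [← EReal.coe_ennreal_lt_coe_ennreal_iff, EReal.coe_ennreal_ofReal] at hA
      exact lt_of_le_of_lt (EReal.coe_le_coe_iff.2 (le_max_left _ _)) hA
    obtain ⟨a, b, hbox, q, hq, hdec⟩ := key _ _ hA'
    refine ⟨_, hbox, c + 1, by linarith, ?_⟩
    filter_upwards [h2 a b A q hq hdec] with N hN
    rw [hN]
    exact zero_le

/-- The second moment bound `h3` needs strict inequalities for all non-empty B, so it is applied in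
a box around θz inside `U`, with θ < 1 close to 1. Contraction does not increase `partialRate`, so
no rate is lost. -/
lemma decaysAtMost_of_modelRate_lt (hp : ∀ i, 0 < p i)
    (hkp : ∀ i, Tendsto (fun N : ℕ => (k N i : ℝ) / (N : ℝ)) atTop (𝓝 (p i)))
    (hLDP : ∀ s, SatisfiesLDP (fun N => (law s N : Measure ℝ)) (I s))
    (hconv : ∀ s, ConvexOn ℝ≥0 Set.univ (I s)) (h0 : ∀ s, I s 0 = 0)
    (h3 : ∀ (a : OrdSeq n → ℚ × ℚ) (b : Fin n → ℚ × ℚ) (η : ℚ), 0 < η →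
      (∀ B : Finset (Fin n), B.Nonempty → DecaysAtMost (fun N => 2 ^ (∑ i ∈ B, k N i) *
        boxProb (fun s => (law s N : Measure ℝ)) (k N) N
          (fun s => ratIoo (a s)) (fun i => ratIoo (b i)) B) (-η)) →
      ∀ᶠ N in atTop, boxProb (fun s => (law s N : Measure ℝ)) (k N) N
        (fun s => ratIoo (a s)) (fun i => ratIoo (b i)) Finset.univ / 2 ≤
        μ N (box (fun s => ratIoo (a s)) (fun i => ratIoo (b i))))
    {z : (OrdSeq n → ℝ) × (Fin n → ℝ)} {U : Set ((OrdSeq n → ℝ) × (Fin n → ℝ))} (hU : U ∈ 𝓝 z)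
    {c : ℝ} (hc : ((modelRate I p z : ℝ≥0∞) : EReal) < c) :
    DecaysAtMost (fun N => μ N U) c := by
  have hz : z ∈ rateSupport I p := by
    by_contra h
    rw [modelRate_of_notMem h] at hc
    simp at hc
  rw [modelRate_of_mem hz] at hc
  have hlim : Tendsto (fun θ : ℝ => θ • z) (𝓝 1) (𝓝 z) := by
    have : ContinuousAt (fun θ : ℝ => θ • z) 1 := by fun_prop
    simpa [ContinuousAt] using this
  obtain ⟨θ, hθU, hθ0, hθ1⟩ : ∃ θ : ℝ, U ∈ 𝓝 (θ • z) ∧ 0 < θ ∧ θ < 1 := by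
    have e1 := (hlim.eventually (eventually_mem_nhds_iff.2 hU)).filter_mono
      (nhdsWithin_le_nhds (s := Set.Iio 1))
    obtain ⟨θ, h, h'⟩ := (e1.and (Ioo_mem_nhdsLT (zero_lt_one' ℝ))).exists
    exact ⟨θ, h, h'.1, h'.2⟩
  obtain ⟨a, b, ha, hb, hsub⟩ := exists_box_subset hθU
  have hw : ∀ i, |(θ • z).2 i| < p i := fun i => by
    have h1 := abs_le_of_partialRate_ne_top hp
      (ne_top_of_le_ne_top ENNReal.ofReal_ne_top (hz Finset.univ)) (Finset.mem_univ i)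
    have h2 : (θ • z).2 i = θ * z.2 i := rfl
    rw [h2, abs_mul, abs_of_pos hθ0]
    nlinarith [hp i]
  obtain ⟨T, hT⟩ : ∃ T : Finset (Fin n) → ℝ, T = fun B => ∑ i ∈ B, p i * Real.log 2 := ⟨_, rfl⟩
  have hTpos : ∀ B : Finset (Fin n), B.Nonempty → 0 < T B := fun B hB => by
    rw [hT]
    exact Finset.sum_pos (fun i _ => mul_pos (hp i) (Real.log_pos one_lt_two)) hB
  -- The margin (1-θ) T(B) is split in three: one third for the error in 2^{k(B)}, one for that in
  -- `boxProb`, and one for the growth rate η of the expected count.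
  obtain ⟨η, hη0, hη⟩ : ∃ η : ℝ, 0 < η ∧ ∀ B : Finset (Fin n), B.Nonempty →
      η ≤ (1 - θ) * T B / 3 := by
    have : ∀ᶠ η : ℝ in 𝓝[>] 0, ∀ B : Finset (Fin n), B.Nonempty → η ≤ (1 - θ) * T B / 3 := by
      rw [eventually_all]
      intro B
      by_cases hB : B.Nonempty
      · have : 0 < (1 - θ) * T B / 3 :=
          div_pos (mul_pos (by linarith) (hTpos B hB)) (by norm_num)
        filter_upwards [Ioo_mem_nhdsGT this] with η hη _
        exact hη.2.le
      · exact Eventually.of_forall fun η h => absurd h hB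
    obtain ⟨η, h, h'⟩ := (this.and self_mem_nhdsWithin).exists
    exact ⟨η, h', h⟩
  obtain ⟨q, hq0, hqη⟩ := exists_rat_btwn hη0
  have hB : ∀ B : Finset (Fin n), B.Nonempty → DecaysAtMost (fun N => 2 ^ (∑ i ∈ B, k N i) *
      boxProb (fun s => (law s N : Measure ℝ)) (k N) N
        (fun s => ratIoo (a s)) (fun i => ratIoo (b i)) B) (-q) := by
    intro B hB
    have hpos : 0 < (1 - θ) * T B / 3 :=
      div_pos (mul_pos (by linarith) (hTpos B hB)) (by norm_num)
    have r1 : partialRate I p B (θ • z) ≤ ENNReal.ofReal (θ * T B) := by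
      refine (partialRate_smul_le hconv h0 B z hθ0 hθ1.le).trans ?_
      rw [ENNReal.ofReal_mul hθ0.le, hT]
      exact mul_le_mul_right (hz B) _
    have r2 : ((partialRate I p B (θ • z) : ℝ≥0∞) : EReal) <
        ((θ * T B + (1 - θ) * T B / 3 : ℝ) : EReal) := by
      refine lt_of_le_of_lt (EReal.coe_ennreal_le_coe_ennreal_iff.2 r1) ?_
      rw [EReal.coe_ennreal_ofReal, max_eq_left (mul_pos hθ0 (hTpos B hB)).le,
        EReal.coe_lt_coe_iff]
      linarith
    have r3 : T B - (1 - θ) * T B / 3 < ∑ i ∈ B, p i * Real.log 2 := by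
      rw [hT] at hpos ⊢
      linarith
    refine ((decaysAtMost_two_pow hkp B r3).mul
      (decaysAtMost_boxProb hp hkp hLDP hw ha hb r2)).mono (fun _ => le_rfl) ?_
    have := hη B hB
    linarith
  have r4 : partialRate I p Finset.univ (θ • z) ≤ partialRate I p Finset.univ z := by
    refine (partialRate_smul_le hconv h0 _ z hθ0 hθ1.le).trans (mul_le_of_le_one_left zero_le ?_)
    simpa using ENNReal.ofReal_le_ofReal hθ1.le
  obtain ⟨c', hc1, hc2⟩ := EReal.lt_iff_exists_real_btwn.1
    (lt_of_le_of_lt (EReal.coe_ennreal_le_coe_ennreal_iff.2 r4) hc)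
  have r5 := (decaysAtMost_boxProb hp hkp hLDP hw ha hb hc1).half (EReal.coe_lt_coe_iff.1 hc2)
  filter_upwards [r5, h3 a b q (by exact_mod_cast hq0) hB] with N hN hN'
  exact hN.trans (hN'.trans (measure_mono hsub))

end Deterministic

lemma satisfiesWeakLDP_of_decays {X : Type*} [TopologicalSpace X] [MeasurableSpace X]
    {μ : ℕ → Measure X} {J : X → ℝ≥0∞} (hJ : LowerSemicontinuous J)
    (hupper : ∀ (x : X) (c : ℝ), (c : EReal) < J x →
      ∃ t ∈ 𝓝 x, ∃ d, c < d ∧ DecaysAtLeast (fun N => μ N t) d)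
    (hlower : ∀ (x : X) (U : Set X) (c : ℝ), U ∈ 𝓝 x → (J x : EReal) < c →
      DecaysAtMost (fun N => μ N U) c) : SatisfiesWeakLDP μ J where
  lsc := hJ
  upper F hF := limsup_log_div_le fun c hc =>
    hF.decaysAtLeast fun x hx => hupper x c (hc.trans_le (iInf₂_le x hx))
  lower G hG := le_liminf_log_div fun c hc => by
    obtain ⟨x, hx, hxc⟩ := by simpa only [iInf_lt_iff, exists_prop] using hc
    exact hlower x G c (hG.mem_nhds hx) hxc

/-- A strong form of exponential tightness: mass outside `K` eventually vanishes, so a closed set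
may be replaced by its compact trace on `K`. -/
lemma SatisfiesWeakLDP.satisfiesLDP {X : Type*} [TopologicalSpace X] [MeasurableSpace X]
    {μ : ℕ → Measure X} {J : X → ℝ≥0∞} (h : SatisfiesWeakLDP μ J) {K : Set X} (hK : IsCompact K)
    (hμ : ∀ᶠ N in atTop, μ N Kᶜ = 0) : SatisfiesLDP μ J where
  lsc := h.lsc
  lower := h.lower
  upper F hF := limsup_log_div_le fun c hc => by
    have hFK : (c : EReal) < ⨅ x ∈ K ∩ F, ((J x : ℝ≥0∞) : EReal) :=
      hc.trans_le (le_iInf₂ fun x hx => iInf₂_le x hx.2)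
    filter_upwards [DecaysAtLeast.of_limsup (h.upper _ (hK.inter_right hF)) hFK, hμ] with N h1 h2
    have hsub : F ⊆ (K ∩ F) ∪ Kᶜ := fun x hx => by
      by_cases hxK : x ∈ K
      · exact Or.inl ⟨hxK, hx⟩
      · exact Or.inr hxK
    calc μ N F ≤ μ N (K ∩ F) + μ N Kᶜ := (measure_mono hsub).trans (measure_union_le _ _)
      _ ≤ _ := by rw [h2, add_zero]; exact h1

lemma empiricalMeasure_eq_zero {n N : ℕ} {k : Fin n → ℕ}
    {ξ : (s : OrdSeq n) → SubConfig k s → ℝ} {F : Set ((OrdSeq n → ℝ) × (Fin n → ℝ))}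
    (hF : MeasurableSet F) (h : ∀ σ : Config k, ((fun s => ξ s (subConfig σ s)),
      (fun i => blockSum (σ i) / (N : ℝ))) ∉ F) : empiricalMeasure N k ξ F = 0 := by
  rw [empiricalMeasure, Measure.smul_apply, Measure.finsetSum_apply, smul_eq_mul,
    Finset.sum_eq_zero, mul_zero]
  intro σ _
  rw [Measure.dirac_apply' _ hF, Set.indicator_of_notMem (h σ)]

lemma abs_blockSum_le {m : ℕ} (τ : Fin m → ℤˣ) : |blockSum τ| ≤ m := by
  refine (Finset.abs_sum_le_sum_abs _ _).trans_eq ?_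
  have : ∀ j, |((τ j : ℤ) : ℝ)| = 1 := fun j => by
    rcases Int.units_eq_one_or (τ j) with h | h <;> simp [h]
  simp [this]

lemma sum_eq_one_of_tendsto {n : ℕ} {k : ℕ → Fin n → ℕ} {p : Fin n → ℝ}
    (hk : ∀ N, n ≤ N → ∑ i, k N i = N)
    (hkp : ∀ i, Tendsto (fun N : ℕ => (k N i : ℝ) / (N : ℝ)) atTop (𝓝 (p i))) :
    ∑ i, p i = 1 := by
  refine tendsto_nhds_unique (tendsto_finsetSum Finset.univ fun i _ => hkp i) ?_
  refine tendsto_const_nhds.congr' ?_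
  filter_upwards [eventually_ge_atTop n, eventually_gt_atTop 0] with N hN h0
  rw [← Finset.sum_div, ← Nat.cast_sum, hk N hN, div_self (by exact_mod_cast h0.ne')]

/-- For each `s`, tails of rate above log 2 beat the number of values of σ(s), so eventually no ξ(s,
·) is large; magnetisations per site are bounded by 1 anyway. -/
lemma ae_exists_isCompact_empiricalMeasure_compl {n : ℕ} {Ω : Type*} [MeasurableSpace Ω]
    {P : Measure Ω} {k : ℕ → Fin n → ℕ} (hk : ∀ N, n ≤ N → ∑ i, k N i = N)
    {p : Fin n → ℝ} (hp : ∀ i, 0 < p i)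
    (hkp : ∀ i, Tendsto (fun N : ℕ => (k N i : ℝ) / (N : ℝ)) atTop (𝓝 (p i)))
    {law : OrdSeq n → ℕ → ProbabilityMeasure ℝ} {I : OrdSeq n → ℝ → ℝ≥0∞}
    (hLDP : ∀ s, SatisfiesLDP (fun N => (law s N : Measure ℝ)) (I s))
    (hconv : ∀ s, ConvexOn ℝ≥0 Set.univ (I s)) (h0 : ∀ s, I s 0 = 0)
    {ξ : (N : ℕ) → (s : OrdSeq n) → SubConfig (k N) s → Ω → ℝ}
    (hξ : ∀ N, n ≤ N → ∀ s τ, HasLaw (ξ N s τ) (law s N : Measure ℝ) P)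
    (hind : ∀ N, n ≤ N →
      iIndepFun (fun q : (Σ s : OrdSeq n, SubConfig (k N) s) => ξ N q.1 q.2) P)
    (hbdd : ∀ s, Bornology.IsBounded {x : ℝ | I s x ≤ ENNReal.ofReal (Real.log 2)}) :
    ∀ᵐ ω ∂P, ∃ K : Set ((OrdSeq n → ℝ) × (Fin n → ℝ)), IsCompact K ∧
      ∀ᶠ N in atTop, empiricalMeasure N (k N) (fun s τ => ξ N s τ ω) Kᶜ = 0 := by
  classical
  choose R hR c hc hdec using fun s => (hLDP s).exists_tail_decaysAtLeast (hconv s) (h0 s)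
    (Real.log_nonneg one_le_two) (hbdd s)
  -- Only the coordinate `s` is constrained, so the general first moment bound with `A` the entries
  -- of `s` reduces to a one-variable tail estimate.
  have hms : ∀ s t, MeasurableSet (if t = s then {x : ℝ | R s ≤ |x|} else Set.univ) := by
    intro s t
    split_ifs
    · exact (isClosed_le continuous_const continuous_abs).measurableSet
    · exact MeasurableSet.univ
  have hprob : ∀ s, DecaysAtLeast (fun N => boxProb (fun t => (law t N : Measure ℝ)) (k N) N
      (fun t => if t = s then {x : ℝ | R s ≤ |x|} else Set.univ) (fun _ => Set.univ)
      (Finset.univ.image s.2)) (c s) := by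
    intro s
    refine (hdec s).mono (fun N => ?_) le_rfl
    refine (mul_le_of_le_one_right zero_le (Finset.prod_le_one' fun i _ => by
      simpa using ENNReal.ofReal_le_ofReal (blockProb_le_one (k N i) N Set.univ))).trans_eq ?_
    rw [energyProb, Finset.prod_eq_single s]
    · simp
    · intro t _ hts
      simp [hts]
    · intro hs
      exact absurd (mem_seqsIn.2 fun j => Finset.mem_image_of_mem _ (Finset.mem_univ j)) hs
  have key : ∀ᵐ ω ∂P, ∀ s, ∀ᶠ N in atTop, ∀ σ : Config (k N),
      |ξ N s (subConfig σ s) ω| ≤ R s := by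
    rw [ae_all_iff]
    intro s
    filter_upwards [ae_eventually_forall_notMem_energyEvent hkp hξ hind (hms s)
      ((sum_mul_log_two_le hp (sum_eq_one_of_tendsto hk hkp) _).trans_lt (hc s)) (hprob s)]
      with ω hω
    filter_upwards [hω] with N hN σ
    by_contra! hcon
    refine hN σ (fun _ _ => Set.mem_univ _) fun t _ => ?_
    by_cases hts : t = s
    · subst hts
      simpa using hcon.le
    · simp [hts]
  filter_upwards [key] with ω hω
  refine ⟨(Set.univ.pi fun s : OrdSeq n => Metric.closedBall (0 : ℝ) (R s)) ×ˢ
      (Set.univ.pi fun _ : Fin n => Metric.closedBall (0 : ℝ) 1),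
    (isCompact_univ_pi fun s => isCompact_closedBall _ _).prod
      (isCompact_univ_pi fun i => isCompact_closedBall _ _), ?_⟩
  filter_upwards [eventually_all.2 hω, eventually_ge_atTop n] with N hN hn
  refine empiricalMeasure_eq_zero ?_ fun σ hσ => hσ ⟨fun s _ => ?_, fun i _ => ?_⟩
  · exact (measurableSet_box (fun s => Metric.isClosed_closedBall.measurableSet)
      fun i => Metric.isClosed_closedBall.measurableSet).compl
  · rw [mem_closedBall_zero_iff, Real.norm_eq_abs]
    exact hN s σ
  · rw [mem_closedBall_zero_iff, Real.norm_eq_abs, abs_div, Nat.abs_cast]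
    refine div_le_one_of_le₀ ((abs_blockSum_le _).trans ?_) (Nat.cast_nonneg _)
    have := Finset.single_le_sum (f := fun i => k N i) (fun _ _ => Nat.zero_le _)
      (Finset.mem_univ i)
    rw [hk N hn] at this
    exact_mod_cast this

/-- The rate functions `I_s` are not assumed to have compact level sets. In that generality
the weak principle holds; as soon as the sets `{I_s ≤ log 2}` are bounded (which is automatic when
rate functions are required to have compact level sets), the full principle holds, and the rate
function `J` has compact level sets. -/
theorem theorem5p1 {n : ℕ} (hn : 1 ≤ n)
    {Ω : Type*} [MeasurableSpace Ω] (P : Measure Ω) [IsProbabilityMeasure P]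
    -- the block sizes
    (k : ℕ → Fin n → ℕ) (hk : ∀ N, n ≤ N → ∑ i, k N i = N)
    (p : Fin n → ℝ) (hp : ∀ i, 0 < p i)
    (hkp : ∀ i, Tendsto (fun N : ℕ => (k N i : ℝ) / (N : ℝ)) atTop (𝓝 (p i)))
    -- the laws and their rate functions
    (law : OrdSeq n → ℕ → ProbabilityMeasure ℝ) (I : OrdSeq n → ℝ → ℝ≥0∞)
    (hlaw : ∀ s, Tendsto (law s) atTop (𝓝 (diracProba (0 : ℝ))))
    (hLDP : ∀ s, SatisfiesLDP (fun N => (law s N : Measure ℝ)) (I s))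
    (hconv : ∀ s, ConvexOn ℝ≥0 Set.univ (I s))
    -- for each `N`, an independent family of random variables with these laws
    (ξ : (N : ℕ) → (s : OrdSeq n) → SubConfig (k N) s → Ω → ℝ)
    (hξ : ∀ N, n ≤ N → ∀ s τ, HasLaw (ξ N s τ) (law s N : Measure ℝ) P)
    (hind : ∀ N, n ≤ N →
      iIndepFun (fun q : (Σ s : OrdSeq n, SubConfig (k N) s) => ξ N q.1 q.2) P) :
    ∀ᵐ ω ∂P,
      SatisfiesWeakLDP (fun N => empiricalMeasure N (k N) (fun s τ => ξ N s τ ω))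
        (modelRate I p) ∧
      ((∀ s, Bornology.IsBounded {x : ℝ | I s x ≤ ENNReal.ofReal (Real.log 2)}) →
        SatisfiesLDP (fun N => empiricalMeasure N (k N) (fun s τ => ξ N s τ ω))
          (modelRate I p) ∧
        ∀ c : ℝ≥0, IsCompact {z | modelRate I p z ≤ (c : ℝ≥0∞)}) := by

  have h0 : ∀ s, I s 0 = 0 := fun s => (hLDP s).rate_zero (hlaw s)
  have hlsc : ∀ s, LowerSemicontinuous (I s) := fun s => (hLDP s).lsc
  -- The quantifiers range over countable types and the decay hypotheses on `boxProb` do not involve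
  -- ω, so a single null set suffices.
  have H1 : ∀ᵐ ω ∂P, ∀ (a : OrdSeq n → ℚ × ℚ) (b : Fin n → ℚ × ℚ) (c d : ℚ), c < d →
      DecaysAtLeast (fun N => boxProb (fun s => (law s N : Measure ℝ)) (k N) N
        (fun s => ratIoo (a s)) (fun i => ratIoo (b i)) Finset.univ) d →
      DecaysAtLeast (fun N => empiricalMeasure N (k N) (fun s τ => ξ N s τ ω)
        (box (fun s => ratIoo (a s)) (fun i => ratIoo (b i)))) c := by
    simp only [ae_all_iff]
    intro a b c d hcd hdec
    exact ae_decaysAtLeast_empiricalMeasure_box hk hξ hind (fun s => measurableSet_ratIoo _)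
      (fun i => measurableSet_ratIoo _) (by exact_mod_cast hcd) hdec
  have H2 : ∀ᵐ ω ∂P, ∀ (a : OrdSeq n → ℚ × ℚ) (b : Fin n → ℚ × ℚ) (A : Finset (Fin n)) (c : ℚ),
      ∑ i ∈ A, p i * Real.log 2 < c →
      DecaysAtLeast (fun N => boxProb (fun s => (law s N : Measure ℝ)) (k N) N
        (fun s => ratIoo (a s)) (fun i => ratIoo (b i)) A) c →
      ∀ᶠ N in atTop, empiricalMeasure N (k N) (fun s τ => ξ N s τ ω)
        (box (fun s => ratIoo (a s)) (fun i => ratIoo (b i))) = 0 := by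
    simp only [ae_all_iff]
    intro a b A c hc hdec
    filter_upwards [ae_eventually_forall_notMem_energyEvent hkp hξ hind
      (fun s => measurableSet_ratIoo (a s)) hc hdec] with ω hω
    filter_upwards [hω] with N hN
    refine empiricalMeasure_eq_zero (measurableSet_box (fun s => measurableSet_ratIoo _)
      fun i => measurableSet_ratIoo _) fun σ hσ => ?_
    exact hN σ (fun i _ => hσ.2 i (Set.mem_univ i)) fun t _ => hσ.1 t (Set.mem_univ t)
  have H3 : ∀ᵐ ω ∂P, ∀ (a : OrdSeq n → ℚ × ℚ) (b : Fin n → ℚ × ℚ) (η : ℚ), 0 < η →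
      (∀ B : Finset (Fin n), B.Nonempty → DecaysAtMost (fun N => 2 ^ (∑ i ∈ B, k N i) *
        boxProb (fun s => (law s N : Measure ℝ)) (k N) N
          (fun s => ratIoo (a s)) (fun i => ratIoo (b i)) B) (-η)) →
      ∀ᶠ N in atTop, boxProb (fun s => (law s N : Measure ℝ)) (k N) N
        (fun s => ratIoo (a s)) (fun i => ratIoo (b i)) Finset.univ / 2 ≤
        empiricalMeasure N (k N) (fun s τ => ξ N s τ ω)
          (box (fun s => ratIoo (a s)) (fun i => ratIoo (b i))) := by
    simp only [ae_all_iff]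
    intro a b η hη hB
    exact ae_eventually_boxProb_le_empiricalMeasure_box hk hξ hind
      (fun s => measurableSet_ratIoo _) (fun i => measurableSet_ratIoo _)
      (by exact_mod_cast hη) hB
  have H4 : ∀ᵐ ω ∂P, (∀ s, Bornology.IsBounded {x : ℝ | I s x ≤ ENNReal.ofReal (Real.log 2)}) →
      ∃ K : Set ((OrdSeq n → ℝ) × (Fin n → ℝ)), IsCompact K ∧
        ∀ᶠ N in atTop, empiricalMeasure N (k N) (fun s τ => ξ N s τ ω) Kᶜ = 0 :=
    eventually_imp_distrib_left.2 fun hbdd =>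
      ae_exists_isCompact_empiricalMeasure_compl hk hp hkp hLDP hconv h0 hξ hind hbdd
  filter_upwards [H1, H2, H3, H4] with ω h1 h2 h3 h4
  have hweak : SatisfiesWeakLDP (fun N => empiricalMeasure N (k N) (fun s τ => ξ N s τ ω))
      (modelRate I p) :=
    satisfiesWeakLDP_of_decays (lowerSemicontinuous_modelRate hlsc)
      (fun z c hc => exists_nhds_decaysAtLeast_of_lt_modelRate hp hkp hLDP h1 h2 hc)
      (fun z U c hU hc => decaysAtMost_of_modelRate_lt hp hkp hLDP hconv h0 h3 hU hc)
  refine ⟨hweak, fun hbdd => ⟨?_, fun c =>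
    isCompact_modelRate_le hp (sum_eq_one_of_tendsto hk hkp) hlsc hbdd c⟩⟩
  obtain ⟨K, hK, hμ⟩ := h4 hbdd
  exact hweak.satisfiesLDP hK hμ
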